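/- Let $K$ be an algebraically closed field of characteristic $0$ and let $X\subset\mathbb{P}^r=\mathbb{P}^r_K$ be an irreducible closed subvariety that is non-degenerate (not contained in a hyperplane). Let $k\ge 0$ and $s$ be integers with $k\le s-1<r$. Write $\mathrm{Seg}(\mathbb{P}^k\times X)\subset\mathbb{P}^{N}$, $N=(k+1)(r+1)-1$, for the image of $\mathbb{P}^k\times X$ under the Segre embedding. For a closed subvariety $Y\subset\mathbb{P}^m$ let $\sigma_s(Y)\subset\mathbb{P}^m$ be the Zariski closure of the union of the linear spans $\langle P_1,\dots,P_s\rangle$ of $s$ distinct points of $Y$. Put $$\delta_s(Y)=\min\{s(\dim Y+1)-1,\;m\}-\dim\sigma_s(Y),$$ and call $Y$ $s$-defective with defect $\delta_s(Y)$ if $\dim\sigma_s(Y)\neq\min\{s(\dim Y+1)-1,\,m\}$. Let $GS_X(k,s)$ be the Zariski closure, in the Grassmannian $\mathbb{G}(k,r)$ of $k$-dimensional linear subspaces of $\mathbb{P}^r$, of the set of those $\Lambda$ that lie in the linear span of $s$ linearly independent points of $X$. Put $$\delta_{k,s}(X)=\min\{s\dim X+(k+1)(s-1-k),\;(k+1)(r-k)\}-\dim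 GS_X(k,s),$$ and call $X$ $(k,s)$-defective with defect $\delta_{k,s}(X)$ if $\dim GS_X(k,s)\neq\min\{s\dim X+(k+1)(s-1-k),\,(k+1)(r-k)\}$. Then, for every integer $\delta$, $X$ is $(k,s)$-defective with defect $\delta_{k,s}(X)=\delta$ if and only if $\mathrm{Seg}(\mathbb{P}^k\times X)$ is $s$-defective with defect $\delta_s(\mathrm{Seg}(\mathbb{P}^k\times X))=\delta$. -/

import Mathlib

open scoped LinearAlgebra.Projectivization

noncomputable section

namespace SecantDefect

/-- A subset of the projective space with homogeneous coordinates indexed by `ι` is algebraic if it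
is the common zero locus of a set of homogeneous polynomials.  (The vanishing of a homogeneous
polynomial at a point does not depend on the representative of the point.) -/
def IsAlgebraicSet {K : Type*} [Field K] {ι : Type*} (Z : Set (ℙ K (ι → K))) : Prop :=
  ∃ S : Set (MvPolynomial ι K), (∀ F ∈ S, ∃ d : ℕ, F.IsHomogeneous d) ∧
    Z = {p | ∀ F ∈ S, MvPolynomial.eval p.rep F = 0}

/-- The Zariski topology on a projective space: the closed sets are the algebraic sets. -/
instance zariskiTopology (K : Type*) [Field K] (ι : Type*) : TopologicalSpace (ℙ K (ι → K)) :=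
  TopologicalSpace.ofClosed {Z | IsAlgebraicSet Z}
    ⟨{1}, by simpa using ⟨0, MvPolynomial.isHomogeneous_one ι K⟩, by ext p; simp⟩
    (by
      intro A hA
      choose S hS hZ using fun (Z : Set (ℙ K (ι → K))) (h : Z ∈ A) => hA h
      refine ⟨⋃ (Z) (h : Z ∈ A), S Z h, ?_, ?_⟩
      · intro F hF
        simp only [Set.mem_iUnion] at hF
        obtain ⟨Z, hZA, hF⟩ := hF
        exact hS Z hZA F hF
      · ext p
        simp only [Set.mem_sInter, Set.mem_iUnion, Set.mem_ofPred_eq]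
        constructor
        · rintro h F ⟨Z, hZA, hF⟩
          have h2 := h Z hZA
          rw [hZ Z hZA] at h2
          exact h2 F hF
        · intro h Z hZA
          rw [hZ Z hZA]
          exact fun F hF => h F ⟨Z, hZA, hF⟩)
    (by
      rintro _ ⟨S, hS, rfl⟩ _ ⟨T, hT, rfl⟩
      refine ⟨Set.image2 (fun F G => F * G) S T, ?_, ?_⟩
      · rintro _ ⟨F, hF, G, hG, rfl⟩
        obtain ⟨d, hd⟩ := hS F hF
        obtain ⟨e, he⟩ := hT G hG
        exact ⟨d + e, hd.mul he⟩
      · ext p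
        simp only [Set.mem_union, Set.mem_ofPred_eq]
        constructor
        · rintro (h | h) _ ⟨F, hF, G, hG, rfl⟩
          · simp [h F hF]
          · simp [h G hG]
        · intro h
          by_contra hcon
          push Not at hcon
          obtain ⟨⟨F, hF, hF0⟩, G, hG, hG0⟩ := hcon
          have := h _ ⟨F, hF, G, hG, rfl⟩
          simp [hF0, hG0] at this)

/-- The (Krull) dimension of a subset of a topological space.  It is used only for nonempty subsets
of projective spaces and of Grassmannians with their Zariski topologies, whose Krull dimension is
finite. -/
def dim {T : Type*} [TopologicalSpace T] (Y : Set T) : ℕ :=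
  ((topologicalKrullDim Y).unbotD 0).toNat

/-- A subset of projective space is non-degenerate if no proper linear subspace contains it. -/
def IsNondegenerate {K : Type*} [Field K] {ι : Type*} (Y : Set (ℙ K (ι → K))) : Prop :=
  ∀ H : Submodule K (ι → K), (∀ p ∈ Y, p.submodule ≤ H) → H = ⊤

/-! ### Secant varieties -/

/-- The linear span of a family of points of projective space, as a vector subspace of the
underlying vector space. -/
def linSpan {K : Type*} [Field K] {ι : Type*} {s : ℕ} (P : Fin s → ℙ K (ι → K)) :
    Submodule K (ι → K) :=
  ⨆ i, (P i).submodule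

/-- The `s`-th secant variety: the Zariski closure of the union of the linear spaces spanned by `s`
distinct points of `Y`. -/
def secantVariety {K : Type*} [Field K] {ι : Type*} (Y : Set (ℙ K (ι → K))) (s : ℕ) :
    Set (ℙ K (ι → K)) :=
  closure {q | ∃ P : Fin s → ℙ K (ι → K),
    Function.Injective P ∧ (∀ i, P i ∈ Y) ∧ q.submodule ≤ linSpan P}

/-- The expected dimension `min {s (dim Y + 1) - 1, m}` of the `s`-th secant variety of `Y ⊆ ℙ^m`,
where `m + 1` is the number of homogeneous coordinates. -/
def expDimSecant {K : Type*} [Field K] {ι : Type*} [Fintype ι] (Y : Set (ℙ K (ι → K))) (s : ℕ) :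
    ℤ :=
  min ((s : ℤ) * ((dim Y : ℤ) + 1) - 1) ((Fintype.card ι : ℤ) - 1)

/-- The `s`-defect of `Y`. -/
def secantDefect {K : Type*} [Field K] {ι : Type*} [Fintype ι] (Y : Set (ℙ K (ι → K))) (s : ℕ) :
    ℤ :=
  expDimSecant Y s - (dim (secantVariety Y s) : ℤ)

/-- `Y` is `s`-defective if its `s`-th secant variety does not have the expected dimension. -/
def IsSecantDefective {K : Type*} [Field K] {ι : Type*} [Fintype ι] (Y : Set (ℙ K (ι → K)))
    (s : ℕ) : Prop :=
  (dim (secantVariety Y s) : ℤ) ≠ expDimSecant Y s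

/-! ### Grassmannians and Grassmann secant varieties -/

/-- The Grassmannian `𝔾(k, m)` of `k`-dimensional linear subspaces of `ℙ^m`, that is, of
`(k + 1)`-dimensional vector subspaces of `K^(m + 1)`. -/
@[ext]
structure Grassmannian (K : Type*) [Field K] (k m : ℕ) where
  /-- The vector subspace. -/
  toSubmodule : Submodule K (Fin (m + 1) → K)
  finrank_eq : Module.finrank K toSubmodule = k + 1

/-- The maximal minors of the matrix with rows `v 0, …, v k`, indexed by the increasing
sequences of `k + 1` columns. -/
def minors {K : Type*} [Field K] {k m : ℕ} (v : Fin (k + 1) → Fin (m + 1) → K) :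
    (Fin (k + 1) ↪o Fin (m + 1)) → K :=
  fun I => (Matrix.of fun i j => v i (I j)).det

theorem minors_ne_zero {K : Type*} [Field K] {k m : ℕ} {v : Fin (k + 1) → Fin (m + 1) → K}
    (hv : LinearIndependent K v) : minors v ≠ 0 := by
  intro h0
  obtain ⟨κ, a, ha, hspan, hli⟩ := exists_linearIndependent' K (Matrix.of v).col
  have hrank : Module.finrank K (Submodule.span K (Set.range (Matrix.of v).col)) = k + 1 := by
    rw [← Matrix.rank_eq_finrank_span_cols]
    have : LinearIndependent K (Matrix.of v).row := hv
    simpa using this.rank_matrix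
  have : Finite κ := Finite.of_injective a ha
  have : Fintype κ := Fintype.ofFinite κ
  have hcard : Fintype.card κ = k + 1 := by
    rw [← hrank, ← hspan, finrank_span_eq_card hli]
  let s : Finset (Fin (m + 1)) := Finset.univ.image a
  have hs : s.card = k + 1 := by
    rw [Finset.card_image_of_injective _ ha, Finset.card_univ, hcard]
  let I : Fin (k + 1) ↪o Fin (m + 1) := s.orderEmbOfFin hs
  have hI : ∀ j, ∃ c, a c = I j := fun j => by
    obtain ⟨c, -, hc⟩ := Finset.mem_image.1 (s.orderEmbOfFin_mem hs j)
    exact ⟨c, hc⟩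
  choose c hc using hI
  have hcinj : Function.Injective c := fun x y hxy => I.injective (by rw [← hc, ← hc, hxy])
  have hli2 := hli.comp c hcinj
  have hdet : (Matrix.of fun i j => v i (I j)).det ≠ 0 := by
    have hcol : LinearIndependent K (Matrix.of fun i j => v i (I j)).col := by
      convert! hli2 using 1
      ext j i
      change v i (I j) = v i (a (c j))
      rw [hc]
    have := Matrix.linearIndependent_cols_iff_isUnit.1 hcol
    exact ((Matrix.isUnit_iff_isUnit_det _).1 this).ne_zero
  exact hdet (congrFun h0 I)

/-- A basis of the vector subspace belonging to an element of the Grassmannian. -/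
def Grassmannian.frame {K : Type*} [Field K] {k m : ℕ} (W : Grassmannian K k m) :
    Fin (k + 1) → Fin (m + 1) → K :=
  fun i => (Module.finBasisOfFinrankEq K W.toSubmodule W.finrank_eq i : Fin (m + 1) → K)

theorem Grassmannian.linearIndependent_frame {K : Type*} [Field K] {k m : ℕ}
    (W : Grassmannian K k m) : LinearIndependent K W.frame :=
  (Module.finBasisOfFinrankEq K W.toSubmodule W.finrank_eq).linearIndependent.map'
    W.toSubmodule.subtype (Submodule.ker_subtype _)

/-- The Plücker embedding, by the maximal minors of the matrix of a basis (another choice of the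
basis multiplies all of them by the same nonzero scalar). -/
def Grassmannian.plucker {K : Type*} [Field K] {k m : ℕ} (W : Grassmannian K k m) :
    ℙ K ((Fin (k + 1) ↪o Fin (m + 1)) → K) :=
  Projectivization.mk K (minors W.frame) (minors_ne_zero W.linearIndependent_frame)

/-- The Zariski topology on the Grassmannian, as a subspace of the Plücker space. -/
instance Grassmannian.zariskiTopology (K : Type*) [Field K] (k m : ℕ) :
    TopologicalSpace (Grassmannian K k m) :=
  TopologicalSpace.induced Grassmannian.plucker inferInstance

/-- The `(k, s)`-Grassmann secant variety of `Y`: the closure in `𝔾(k, m)` of the set of the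
`k`-spaces that lie in the linear span of `s` independent points of `Y`. -/
def grassmannSecantVariety {K : Type*} [Field K] {m : ℕ} (Y : Set (ℙ K (Fin (m + 1) → K)))
    (k s : ℕ) : Set (Grassmannian K k m) :=
  closure {W | ∃ P : Fin s → ℙ K (Fin (m + 1) → K),
    Projectivization.Independent P ∧ (∀ i, P i ∈ Y) ∧ W.toSubmodule ≤ linSpan P}

/-- The expected dimension `min {s dim Y + (k + 1)(s - 1 - k), (k + 1)(m - k)}` of the
`(k, s)`-Grassmann secant variety of `Y ⊆ ℙ^m`. -/
def expDimGrassmannSecant {K : Type*} [Field K] {m : ℕ} (Y : Set (ℙ K (Fin (m + 1) → K)))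
    (k s : ℕ) : ℤ :=
  min ((s : ℤ) * (dim Y : ℤ) + ((k : ℤ) + 1) * ((s : ℤ) - 1 - k)) (((k : ℤ) + 1) * ((m : ℤ) - k))

/-- The `(k, s)`-defect of `Y`. -/
def grassmannDefect {K : Type*} [Field K] {m : ℕ} (Y : Set (ℙ K (Fin (m + 1) → K)))
    (k s : ℕ) : ℤ :=
  expDimGrassmannSecant Y k s - (dim (grassmannSecantVariety Y k s) : ℤ)

/-- `Y` is `(k, s)`-defective if its `(k, s)`-Grassmann secant variety does not have the expected
dimension. -/
def IsGrassmannDefective {K : Type*} [Field K] {m : ℕ} (Y : Set (ℙ K (Fin (m + 1) → K)))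
    (k s : ℕ) : Prop :=
  (dim (grassmannSecantVariety Y k s) : ℤ) ≠ expDimGrassmannSecant Y k s

/-! ### Segre products -/

theorem segre_ne_zero {K : Type*} [Field K] {ι κ : Type*} {a : ι → K} {b : κ → K} (ha : a ≠ 0)
    (hb : b ≠ 0) : (fun ij : ι × κ => a ij.1 * b ij.2) ≠ 0 := by
  obtain ⟨i, hi⟩ := Function.ne_iff.1 ha
  obtain ⟨j, hj⟩ := Function.ne_iff.1 hb
  exact Function.ne_iff.2 ⟨(i, j), mul_ne_zero hi hj⟩

/-- The Segre embedding `([a], [b]) ↦ [a i * b j]`. -/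
def segreMap {K : Type*} [Field K] {ι κ : Type*} (p : ℙ K (ι → K)) (q : ℙ K (κ → K)) :
    ℙ K (ι × κ → K) :=
  Projectivization.mk K (fun ij => p.rep ij.1 * q.rep ij.2)
    (segre_ne_zero p.rep_nonzero q.rep_nonzero)

/-- The Segre product `Seg(ℙ^k × X) ⊆ ℙ^N` of `ℙ^k` and `X ⊆ ℙ^r`, where
`N + 1 = (k + 1) * (r + 1)`: the image of `ℙ^k × X` under the Segre embedding. -/
def segreProduct {K : Type*} [Field K] {r : ℕ} (k : ℕ) (X : Set (ℙ K (Fin (r + 1) → K))) :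
    Set (ℙ K (Fin (k + 1) × Fin (r + 1) → K)) :=
  Set.image2 segreMap Set.univ X

end SecantDefect

end

noncomputable section

namespace SecantDefect

/-! ### Krull dimension of finitely generated domains -/

/-! Both defects are the same number. By `dim_segreProduct`, the Segre product has dimension `dim X
+ k`. By `dim_secantVariety_segreProduct`, the dimension of its secant variety exceeds that of the
Grassmann secant variety by `(k + 1)² - 1`. Both entries of the expected minimum grow by this amount
too, since `(k + 1)(s - 1 - k) + (k + 1)² = s(k + 1)` and `(k + 1)(r - k) + (k + 1)² = (k + 1)(r +
1)`.

The shift is the dimension of `PGL(k + 1)`. A point of the ambient space of the Segre product is a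
matrix `M` up to scalar, and a sum of `s` tensors `aᵢ ⊗ xᵢ` is a product `Aᵀ x`. Hence a matrix of
full rank is such a sum, with given `xᵢ`, exactly when its row space lies in the span of the `xᵢ`
(`rowSpace_mem_spannedSpaces_iff`). Sums that are not of full rank, or whose points are dependent,
do not affect the closure: the parameter space is irreducible, and non-degeneracy with `k + 1 ≤ s ≤
r + 1` makes the regular parameters a nonempty open subset (`secantVariety_segreProduct`).

On matrices of full rank, taking the row space is a locally trivial fibration: where the minor `I`
is nonzero, `M = g N` uniquely, with `g` invertible and `N` in the cell of `I`. This map is open, so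
preimages commute with closures, and one open piece of the secant variety becomes an open part of a
product (`chartSet_closure_regularTensors`). No theorem on dimensions of fibres is needed, only that
an irreducible closed set has the same dimension as each of its nonempty open subsets (`IsEquidim`)
and that a product with an affine space has the expected dimension (`isEquidim_hyperplaneProd`). -/

/-- Going-up, one prime at a time; the condition on the last primes is what allows the lifted chain
to be extended. -/
theorem exists_ltSeries_of_isIntegral {B A : Type*} [CommRing B] [CommRing A] [Algebra B A]
    [Algebra.IsIntegral B A] [FaithfulSMul B A] (n : ℕ) :
    ∀ p : LTSeries (PrimeSpectrum B), p.length = n →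
      ∃ q : LTSeries (PrimeSpectrum A), q.length = n ∧
        q.last.asIdeal.comap (algebraMap B A) = p.last.asIdeal := by
  induction n with
  | zero =>
    intro p hp
    obtain ⟨Q, -, hQ, hQP⟩ := Ideal.exists_ideal_over_prime_of_isIntegral p.last.asIdeal
      (⊥ : Ideal A) (by
        intro x hx
        have : x = 0 := by simpa using hx
        simp [this])
    exact ⟨RelSeries.singleton _ ⟨Q, hQ⟩, rfl, hQP⟩
  | succ n ih =>
    intro p hp
    have hne : p.length ≠ 0 := by omega
    obtain ⟨q, hq, hqp⟩ := ih p.eraseLast (by simp [hp])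
    have hlt : p.eraseLast.last < p.last := p.eraseLast_last_rel_last hne
    obtain ⟨Q, hle, hQ, hQP⟩ := Ideal.exists_ideal_over_prime_of_isIntegral p.last.asIdeal
      q.last.asIdeal (by rw [hqp]; exact hlt.le)
    have hlt' : q.last < (⟨Q, hQ⟩ : PrimeSpectrum A) := by
      refine lt_of_le_of_ne hle fun h => hlt.ne ?_
      ext1
      rw [← hqp, ← hQP, h]
    refine ⟨q.snoc ⟨Q, hQ⟩ hlt', by simp [hq], ?_⟩
    simpa using hQP

/-- Incomparability gives one inequality and going-up the other. -/
theorem ringKrullDim_eq_of_isIntegral (B A : Type*) [CommRing B] [CommRing A] [Algebra B A]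
    [Algebra.IsIntegral B A] [FaithfulSMul B A] : ringKrullDim A = ringKrullDim B := by
  apply le_antisymm
  · refine Order.krullDim_le_of_strictMono (PrimeSpectrum.comap (algebraMap B A)) ?_
    intro P Q h
    exact Ideal.IsIntegral.comap_lt_comap (R := B) h
  · refine iSup_le fun p => ?_
    obtain ⟨q, hq, -⟩ := exists_ltSeries_of_isIntegral (A := A) _ p rfl
    rw [← hq]
    exact le_iSup (fun q : LTSeries (PrimeSpectrum A) => (q.length : WithBot ℕ∞)) q

/-- Noether normalization reduces to a polynomial ring, where both numbers count the variables. -/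
theorem ringKrullDim_eq_toNat_trdeg (K A : Type*) [Field K] [CommRing A] [IsDomain A]
    [Algebra K A] [Algebra.FiniteType K A] :
    ringKrullDim A = ((Algebra.trdeg K A).toNat : WithBot ℕ∞) := by
  obtain ⟨s, g, hinj, hint⟩ := exists_integral_inj_algHom_of_fg K A
  let _ : Algebra (MvPolynomial (Fin s) K) A := g.toRingHom.toAlgebra
  have : IsScalarTower K (MvPolynomial (Fin s) K) A :=
    IsScalarTower.of_algebraMap_eq fun x => (g.commutes x).symm
  have : Algebra.IsIntegral (MvPolynomial (Fin s) K) A := ⟨hint⟩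
  have : FaithfulSMul (MvPolynomial (Fin s) K) A :=
    (faithfulSMul_iff_algebraMap_injective _ _).2 hinj
  have h1 := lift_trdeg_add_eq K (MvPolynomial (Fin s) K) A
  rw [MvPolynomial.trdeg_of_isDomain, trdeg_eq_zero] at h1
  have h2 := congrArg Cardinal.toNat h1
  simp at h2
  rw [ringKrullDim_eq_of_isIntegral (MvPolynomial (Fin s) K) A, ← h2]
  simp

/-- Inverting an element is an algebraic extension, so the transcendence degree over `K` is
unchanged. -/
theorem ringKrullDim_localizationAway (K : Type*) {A : Type*} [Field K] [CommRing A] [IsDomain A]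
    [Algebra K A] [Algebra.FiniteType K A] {f : A} (hf : f ≠ 0) :
    ringKrullDim (Localization.Away f) = ringKrullDim A := by
  have hle : Submonoid.powers f ≤ nonZeroDivisors A := powers_le_nonZeroDivisors_of_noZeroDivisors hf
  have : IsDomain (Localization.Away f) := IsLocalization.isDomain_localization hle
  have : FaithfulSMul A (Localization.Away f) :=
    (faithfulSMul_iff_algebraMap_injective _ _).2 (IsLocalization.injective _ hle)
  have : Algebra.FiniteType A (Localization.Away f) := IsLocalization.finiteType_of_monoid_fg (Submonoid.powers f) _
  have : Algebra.FiniteType K (Localization.Away f) := Algebra.FiniteType.trans (S := A) inferInstance inferInstance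
  have : Algebra.IsAlgebraic A (Localization.Away f) := IsLocalization.isAlgebraic _ (Submonoid.powers f)
  rw [ringKrullDim_eq_toNat_trdeg K, ringKrullDim_eq_toNat_trdeg K A,
    ← trdeg_add_eq K A (A := Localization.Away f), trdeg_eq_zero (R := A), add_zero]

open Topology TopologicalSpace

/-! ### Topological Krull dimension and irreducibility -/


/-- Only separate continuity is assumed, because the Zariski topology of a product is finer than the
product topology. A common second argument is found first, then a common first one. -/
theorem isIrreducible_image2 {T₁ T₂ T : Type*} [TopologicalSpace T₁] [TopologicalSpace T₂]
    [TopologicalSpace T] {m : T₁ → T₂ → T} (h₁ : ∀ y, Continuous fun x => m x y)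
    (h₂ : ∀ x, Continuous (m x)) {S₁ : Set T₁} {S₂ : Set T₂} (hS₁ : IsIrreducible S₁)
    (hS₂ : IsIrreducible S₂) : IsIrreducible (Set.image2 m S₁ S₂) := by
  refine ⟨hS₁.1.image2 hS₂.1, ?_⟩
  rintro U V hU hV ⟨_, ⟨x, hx, y, hy, rfl⟩, hxyU⟩ ⟨_, ⟨x', hx', y', hy', rfl⟩, hxyV⟩
  obtain ⟨z, hz, hzU, hzV⟩ := hS₂.2 _ _ (hU.preimage (h₂ x)) (hV.preimage (h₂ x'))
    ⟨y, hy, hxyU⟩ ⟨y', hy', hxyV⟩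
  obtain ⟨w, hw, hwU, hwV⟩ := hS₁.2 _ _ (hU.preimage (h₁ z)) (hV.preimage (h₁ z))
    ⟨x, hx, hzU⟩ ⟨x', hx', hzV⟩
  exact ⟨m w z, ⟨w, hw, z, hz, rfl⟩, hwU, hwV⟩

/-- Two points with images in `U` and `V` are changed one coordinate at a time until they coincide.
-/
theorem isIrreducible_image_pi {ι : Type*} [Fintype ι] [DecidableEq ι] {T : ι → Type*} {Y : Type*}
    [∀ i, TopologicalSpace (T i)] [TopologicalSpace Y] {m : (∀ i, T i) → Y}
    (h : ∀ x i, Continuous fun t => m (Function.update x i t)) {S : ∀ i, Set (T i)}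
    (hS : ∀ i, IsIrreducible (S i)) : IsIrreducible (m '' Set.univ.pi S) := by
  refine ⟨(Set.univ_pi_nonempty_iff.2 fun i => (hS i).1).image m, ?_⟩
  rintro U V hU hV ⟨_, ⟨x, hx, rfl⟩, hxU⟩ ⟨_, ⟨y, hy, rfl⟩, hyV⟩
  have key : ∀ F : Finset ι, ∃ x ∈ Set.univ.pi S, ∃ y ∈ Set.univ.pi S, m x ∈ U ∧ m y ∈ V ∧
      ∀ i ∈ F, x i = y i := by
    intro F
    induction F using Finset.induction_on with
    | empty => exact ⟨x, hx, y, hy, hxU, hyV, by simp⟩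
    | insert i F _ ih =>
      obtain ⟨x, hx, y, hy, hxU, hyV, hxy⟩ := ih
      obtain ⟨z, hz, hzU, hzV⟩ := (hS i).2 _ _ (hU.preimage (h x i)) (hV.preimage (h y i))
        ⟨x i, hx i trivial, by simpa using hxU⟩ ⟨y i, hy i trivial, by simpa using hyV⟩
      refine ⟨Function.update x i z, ?_, Function.update y i z, ?_, hzU, hzV, ?_⟩
      · exact (Set.update_mem_pi_iff_of_mem hx).2 fun _ => hz
      · exact (Set.update_mem_pi_iff_of_mem hy).2 fun _ => hz
      · intro j hj
        by_cases hji : j = i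
        · subst hji; simp
        · simp [hji, hxy j ((Finset.mem_insert.1 hj).resolve_left hji)]
  obtain ⟨x, hx, y, hy, hxU, hyV, hxy⟩ := key Finset.univ
  obtain rfl : x = y := funext fun i => hxy i (Finset.mem_univ i)
  exact ⟨m x, ⟨x, hx, rfl⟩, hxU, hyV⟩

theorem isIrreducible_image_iff {T T' : Type*} [TopologicalSpace T] [TopologicalSpace T']
    {f : T → T'} (hf : IsInducing f) {S : Set T} : IsIrreducible (f '' S) ↔ IsIrreducible S := by
  refine ⟨fun h => ⟨h.1.of_image, ?_⟩, fun h => h.image f hf.continuous.continuousOn⟩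
  rintro U V hU hV ⟨x, hx, hxU⟩ ⟨y, hy, hyV⟩
  obtain ⟨U, hU', rfl⟩ := hf.isOpen_iff.1 hU
  obtain ⟨V, hV', rfl⟩ := hf.isOpen_iff.1 hV
  obtain ⟨_, ⟨z, hz, rfl⟩, hzU, hzV⟩ := h.2 U V hU' hV' ⟨_, ⟨x, hx, rfl⟩, hxU⟩
    ⟨_, ⟨y, hy, rfl⟩, hyV⟩
  exact ⟨z, hz, hzU, hzV⟩

theorem IsIrreducible.inter_isOpen {T : Type*} [TopologicalSpace T] {S U : Set T}
    (hS : IsIrreducible S) (hU : IsOpen U) (hne : (S ∩ U).Nonempty) : IsIrreducible (S ∩ U) := by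
  refine ⟨hne, ?_⟩
  rintro V W hV hW ⟨x, hx, hxV⟩ ⟨y, hy, hyW⟩
  obtain ⟨z, hz, ⟨hzU, hzV⟩, -, hzW⟩ := hS.2 _ _ (hU.inter hV) (hU.inter hW)
    ⟨x, hx.1, hx.2, hxV⟩ ⟨y, hy.1, hy.2, hyW⟩
  exact ⟨z, ⟨hz, hzU⟩, hzV, hzW⟩

/-- The hypothesis says that each closed set is recovered from its trace on `T`, so irreducible
closed sets pull back injectively. It will be applied to the `K`-points inside a prime spectrum. -/
theorem topologicalKrullDim_eq_of_isInducing {T T' : Type*} [TopologicalSpace T]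
    [TopologicalSpace T'] {f : T → T'} (hf : IsInducing f)
    (h : ∀ C : Set T', IsClosed C → C ⊆ closure (f '' (f ⁻¹' C))) :
    topologicalKrullDim T = topologicalKrullDim T' := by
  refine le_antisymm hf.topologicalKrullDim_le ?_
  have hcl : ∀ C : Set T', IsClosed C → closure (f '' (f ⁻¹' C)) = C := fun C hC =>
    (closure_minimal (Set.image_preimage_subset _ _) hC).antisymm (h C hC)
  refine Order.krullDim_le_of_strictMono (fun C : IrreducibleCloseds T' =>
    (⟨f ⁻¹' C, ?_, C.isClosed.preimage hf.continuous⟩ : IrreducibleCloseds T)) ?_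
  · rw [← isIrreducible_image_iff hf, ← isIrreducible_iff_closure, hcl _ C.isClosed]
    exact C.isIrreducible
  · refine Monotone.strictMono_of_injective (fun C D hCD x hx => hCD hx) ?_
    intro C D hCD
    have hCD' : f ⁻¹' (C : Set T') = f ⁻¹' (D : Set T') := congrArg (fun E : IrreducibleCloseds T => (E : Set T)) hCD
    ext1
    rw [← hcl _ C.isClosed, hCD', hcl _ D.isClosed]

theorem topologicalKrullDim_image {T T' : Type*} [TopologicalSpace T] [TopologicalSpace T']
    {f : T → T'} (hf : IsEmbedding f) (S : Set T) :
    topologicalKrullDim (f '' S) = topologicalKrullDim S :=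
  (IsHomeomorph.topologicalKrullDim_eq _ (hf.homeomorphImage S).isHomeomorph).symm

theorem topologicalKrullDim_mono {T : Type*} [TopologicalSpace T] {S S' : Set T} (h : S ⊆ S') :
    topologicalKrullDim S ≤ topologicalKrullDim S' :=
  (IsEmbedding.inclusion h).isInducing.topologicalKrullDim_le

/-- Every member of a chain contains the smallest one, so an open set that meets the smallest member
meets them all and sees the whole chain. -/
theorem topologicalKrullDim_le_of_isOpen_cover {T : Type*} [TopologicalSpace T] {S : Set T}
    {ι : Type*} {U : ι → Set T} (hU : ∀ i, IsOpen (U i)) (hcov : ∀ x ∈ S, ∃ i, x ∈ U i)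
    {n : WithBot ℕ∞} (h : ∀ i, (S ∩ U i).Nonempty → topologicalKrullDim ↥(S ∩ U i) ≤ n) :
    topologicalKrullDim S ≤ n := by
  refine iSup_le fun p => ?_
  obtain ⟨x, hx⟩ := p.head.isIrreducible.nonempty
  obtain ⟨i, hi⟩ := hcov x x.2
  refine le_trans ?_ (h i ⟨x, x.2, hi⟩)
  let V : Set S := Subtype.val ⁻¹' U i
  have hV : IsOpen V := (hU i).preimage continuous_subtype_val
  have hVi : (Subtype.val '' V : Set T) = S ∩ U i := Subtype.image_preimage_coe S (U i)
  rw [← hVi, topologicalKrullDim_image IsEmbedding.subtypeVal]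
  let e := IrreducibleCloseds.orderIsoOfIsOpenEmbedding (Subtype.val : V → S) hV.isOpenEmbedding_subtypeVal
  let q : LTSeries {W : IrreducibleCloseds S | ((Subtype.val : V → S) ⁻¹' W).Nonempty} :=
    { length := p.length
      toFun := fun j => ⟨p j, ⟨⟨x, hi⟩, p.head_le j hx⟩⟩
      step := fun j => p.step j }
  let q' : LTSeries (IrreducibleCloseds V) := q.map e.symm e.symm.strictMono
  exact le_iSup (fun q : LTSeries (IrreducibleCloseds V) => (q.length : WithBot ℕ∞)) q'

/-- A set all of whose nonempty relatively open subsets have Krull dimension `n`. -/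
def IsEquidim {T : Type*} [TopologicalSpace T] (S : Set T) (n : ℕ) : Prop :=
  ∀ U : Set T, IsOpen U → (S ∩ U).Nonempty → topologicalKrullDim ↥(S ∩ U) = n

theorem IsEquidim.topologicalKrullDim_eq {T : Type*} [TopologicalSpace T] {S : Set T} {n : ℕ}
    (h : IsEquidim S n) (hS : S.Nonempty) : topologicalKrullDim S = n := by
  have := h Set.univ isOpen_univ (by simpa using hS)
  rwa [Set.inter_univ] at this

theorem dim_eq_of_topologicalKrullDim_eq {T : Type*} [TopologicalSpace T] {S : Set T} {n : ℕ}
    (h : topologicalKrullDim S = n) : dim S = n := by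
  rw [dim, h]
  rfl

theorem IsEquidim.dim_eq {T : Type*} [TopologicalSpace T] {S : Set T} {n : ℕ}
    (h : IsEquidim S n) (hS : S.Nonempty) : dim S = n :=
  dim_eq_of_topologicalKrullDim_eq (h.topologicalKrullDim_eq hS)

theorem IsEquidim.inter_isOpen {T : Type*} [TopologicalSpace T] {S U : Set T} {n : ℕ}
    (h : IsEquidim S n) (hU : IsOpen U) : IsEquidim (S ∩ U) n := by
  intro V hV hne
  rw [Set.inter_assoc] at hne ⊢
  exact h _ (hU.inter hV) hne

theorem isEquidim_image_iff {T T' : Type*} [TopologicalSpace T] [TopologicalSpace T'] {f : T → T'}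
    (hf : IsEmbedding f) {S : Set T} {n : ℕ} : IsEquidim (f '' S) n ↔ IsEquidim S n := by
  have key : ∀ U : Set T', f '' S ∩ U = f '' (S ∩ f ⁻¹' U) := fun U => Set.image_inter_preimage f S U |>.symm
  constructor
  · intro h U hU hne
    obtain ⟨U, hU', rfl⟩ := hf.isInducing.isOpen_iff.1 hU
    rw [← topologicalKrullDim_image hf, ← key]
    exact h U hU' (by rw [key]; exact hne.image f)
  · intro h U hU hne
    rw [key] at hne ⊢
    rw [topologicalKrullDim_image hf]
    exact h _ (hU.preimage hf.continuous) hne.of_image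

/-- Any two nonempty open pieces of an irreducible set meet, and their common part has the dimension
of each of them. -/
theorem exists_isEquidim_of_isOpen_cover {T : Type*} [TopologicalSpace T] {S : Set T}
    (hS : IsIrreducible S) {ι : Type*} {U : ι → Set T} (hU : ∀ i, IsOpen (U i))
    (hcov : ∀ x ∈ S, ∃ i, x ∈ U i)
    (h : ∀ i, (S ∩ U i).Nonempty → ∃ n, IsEquidim (S ∩ U i) n) : ∃ n, IsEquidim S n := by
  obtain ⟨x, hx⟩ := hS.1
  obtain ⟨i, hi⟩ := hcov x hx
  obtain ⟨n, hn⟩ := h i ⟨x, hx, hi⟩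
  have hall : ∀ j, (S ∩ U j).Nonempty → IsEquidim (S ∩ U j) n := by
    intro j hj
    obtain ⟨m, hm⟩ := h j hj
    have hij := hS.2 _ _ (hU i) (hU j) ⟨x, hx, hi⟩ hj
    have h1 := hn (U j) (hU j) (by rwa [Set.inter_assoc])
    have h2 := hm (U i) (hU i) (by rwa [Set.inter_assoc, Set.inter_comm (U j)])
    rw [Set.inter_assoc] at h1
    rw [Set.inter_assoc, Set.inter_comm (U j), h1] at h2
    have hmn : n = m := by exact_mod_cast h2
    rwa [hmn]
  refine ⟨n, fun V hV hne => le_antisymm ?_ ?_⟩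
  · refine topologicalKrullDim_le_of_isOpen_cover hU (fun y hy => hcov y hy.1) fun j hj => ?_
    rw [Set.inter_assoc, Set.inter_comm V, ← Set.inter_assoc] at hj ⊢
    exact (hall j (hj.mono Set.inter_subset_left) V hV hj).le
  · obtain ⟨y, hy, hyV⟩ := hne
    obtain ⟨j, hj⟩ := hcov y hy
    rw [← hall j ⟨y, hy, hj⟩ V hV ⟨y, ⟨hy, hj⟩, hyV⟩]
    exact topologicalKrullDim_mono fun z hz => ⟨hz.1.1, hz.2⟩

open MvPolynomial

/-! ### Affine spaces with the Zariski topology -/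


/-- The Zariski topology on the affine space with coordinates indexed by `ι`. -/
@[reducible]
def affineZariski (K : Type*) [Field K] (ι : Type*) : TopologicalSpace (ι → K) :=
  TopologicalSpace.induced (MvPolynomial.pointToPoint (k := K)) inferInstance


attribute [local instance] affineZariski

theorem isClosed_affine_iff {K ι : Type*} [Field K] {Z : Set (ι → K)} :
    IsClosed Z ↔ ∃ S : Set (MvPolynomial ι K), Z = {x | ∀ F ∈ S, eval x F = 0} := by
  have key : ∀ S : Set (MvPolynomial ι K),
      pointToPoint (k := K) ⁻¹' (PrimeSpectrum.zeroLocus S) = {x : ι → K | ∀ F ∈ S, eval x F = 0} := by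
    intro S
    ext x
    rw [Set.mem_preimage, PrimeSpectrum.mem_zeroLocus]
    refine forall₂_congr fun F _ => ?_
    change F ∈ vanishingIdeal K {x} ↔ _
    rw [mem_vanishingIdeal_singleton_iff, ← RingHom.coe_coe, coe_aeval_eq_eval]
  rw [isClosed_induced_iff]
  constructor
  · rintro ⟨C, hC, rfl⟩
    obtain ⟨S, rfl⟩ := (PrimeSpectrum.isClosed_iff_zeroLocus _).1 hC
    exact ⟨S, key S⟩
  · rintro ⟨S, rfl⟩
    exact ⟨_, PrimeSpectrum.isClosed_zeroLocus S, key S⟩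

theorem isClosed_zeros {K ι : Type*} [Field K] (F : MvPolynomial ι K) :
    IsClosed {x : ι → K | eval x F = 0} :=
  isClosed_affine_iff.2 ⟨{F}, by simp⟩

/-- The `K`-algebra `A` is a ring of coordinates on the space `T`: the closed subsets of `T` are
the zero loci of elements of `A`, and every `K`-point of `A` is the evaluation at a point of `T`. -/
structure IsAffineModel {K T A : Type*} [Field K] [TopologicalSpace T] [CommRing A] [Algebra K A]
    (ev : A →ₐ[K] (T → K)) : Prop where
  isClosed_iff : ∀ Z : Set T, IsClosed Z ↔ ∃ S : Set A, Z = {t | ∀ a ∈ S, ev a t = 0}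
  exists_eval : ∀ φ : A →ₐ[K] K, ∃ t, ∀ a, φ a = ev a t

/-! ### Nullstellensatz and the dimension of affine models -/

/-- Zariski's lemma: the residue field is finite over `K`, hence embeds in the algebraically closed
field `K`. -/
theorem exists_algHom_of_isMaximal {K A : Type*} [Field K] [IsAlgClosed K] [CommRing A]
    [Algebra K A] [Algebra.FiniteType K A] (m : Ideal A) [m.IsMaximal] :
    ∃ φ : A →ₐ[K] K, ∀ a, φ a = 0 ↔ a ∈ m := by
  let _ : Field (A ⧸ m) := Ideal.Quotient.field m
  have : Module.Finite K (A ⧸ m) := finite_of_finite_type_of_isJacobsonRing K (A ⧸ m)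
  let φ : (A ⧸ m) →ₐ[K] K := IsAlgClosed.lift
  refine ⟨φ.comp (Ideal.Quotient.mkₐ K m), fun a => ?_⟩
  rw [AlgHom.comp_apply, map_eq_zero_iff φ (RingHom.injective φ.toRingHom),
    Ideal.Quotient.mkₐ_eq_mk, Ideal.Quotient.eq_zero_iff_mem]

/-- Sending a point to the kernel of its evaluation induces the topology of `T` from the spectrum of
`A`, and the points are dense in each closed set by the Nullstellensatz. -/
theorem IsAffineModel.topologicalKrullDim_eq {K T A : Type*} [Field K] [IsAlgClosed K]
    [TopologicalSpace T] [CommRing A] [Algebra K A] [Algebra.FiniteType K A]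
    {ev : A →ₐ[K] (T → K)} (h : IsAffineModel ev) : topologicalKrullDim T = ringKrullDim A := by
  let ε : T → (A →+* K) := fun t => (Pi.evalRingHom (fun _ : T => K) t).comp ev.toRingHom
  let j : T → PrimeSpectrum A := fun t => ⟨RingHom.ker (ε t), RingHom.ker_isPrime _⟩
  have hj : ∀ S : Set A, j ⁻¹' PrimeSpectrum.zeroLocus S = {t | ∀ a ∈ S, ev a t = 0} :=
    fun S => rfl
  rw [← PrimeSpectrum.topologicalKrullDim_eq_ringKrullDim]
  refine topologicalKrullDim_eq_of_isInducing (f := j) ?_ ?_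
  · rw [isInducing_iff, TopologicalSpace.ext_iff_isClosed]
    intro Z
    rw [h.isClosed_iff, isClosed_induced_iff]
    constructor
    · rintro ⟨S, rfl⟩
      exact ⟨_, PrimeSpectrum.isClosed_zeroLocus S, hj S⟩
    · rintro ⟨C, hC, rfl⟩
      obtain ⟨S, rfl⟩ := (PrimeSpectrum.isClosed_iff_zeroLocus _).1 hC
      exact ⟨S, hj S⟩
  · intro C hC p hp
    obtain ⟨S, rfl⟩ := (PrimeSpectrum.isClosed_iff_zeroLocus _).1 hC
    rw [← PrimeSpectrum.zeroLocus_vanishingIdeal_eq_closure, PrimeSpectrum.mem_zeroLocus]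
    intro f hf
    have : IsJacobsonRing A := isJacobsonRing_of_finiteType (A := K)
    change f ∈ p.asIdeal
    -- In a Jacobson ring a prime is the intersection of the maximal ideals above it, and each of
    -- these is the kernel of evaluation at a point of `T`.
    rw [← (isJacobsonRing_iff.1 this p.asIdeal p.isPrime.isRadical), Ideal.jacobson, Ideal.mem_sInf]
    rintro m ⟨hpm, hm⟩
    obtain ⟨φ, hφ⟩ := exists_algHom_of_isMaximal (K := K) m
    obtain ⟨t, ht⟩ := h.exists_eval φ
    have htS : t ∈ j ⁻¹' PrimeSpectrum.zeroLocus S := by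
      rw [hj]
      intro a ha
      rw [← ht, hφ]
      exact hpm (hp ha)
    have := (PrimeSpectrum.mem_vanishingIdeal _ _).1 hf _ ⟨t, htS, rfl⟩
    rw [← hφ, ht]
    exact this

/-- The evaluation map of a localization on the complement of the zeros. -/
def evalAway {K T A : Type*} [Field K] [CommRing A] [Algebra K A] (ev : A →ₐ[K] (T → K)) (f : A) :
    Localization.Away f →ₐ[K] ({t | ev f t ≠ 0} → K) :=
  IsLocalization.liftAlgHom (M := Submonoid.powers f)
    (f := (AlgHom.pi (A := fun _ : {t | ev f t ≠ 0} => K) fun t =>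
      (Pi.evalAlgHom K (fun _ : T => K) t.1).comp ev)) (by
      rintro ⟨_, n, rfl⟩
      rw [map_pow]
      refine IsUnit.pow n (isUnit_iff_exists_inv.2 ⟨fun t => (ev f t.1)⁻¹, ?_⟩)
      ext t
      exact mul_inv_cancel₀ t.2)

theorem evalAway_algebraMap {K T A : Type*} [Field K] [CommRing A] [Algebra K A]
    (ev : A →ₐ[K] (T → K)) (f a : A) (t : {t | ev f t ≠ 0}) :
    evalAway ev f (algebraMap A _ a) t = ev a t := by
  rw [evalAway, IsLocalization.coe_liftAlgHom, IsLocalization.lift_eq]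
  rfl

theorem IsAffineModel.away {K T A : Type*} [Field K] [TopologicalSpace T] [CommRing A]
    [Algebra K A] {ev : A →ₐ[K] (T → K)} (h : IsAffineModel ev) (f : A) :
    IsAffineModel (evalAway ev f) := by
  constructor
  · intro Z
    rw [isClosed_induced_iff]
    constructor
    · rintro ⟨C, hC, rfl⟩
      obtain ⟨S, rfl⟩ := (h.isClosed_iff C).1 hC
      refine ⟨algebraMap A _ '' S, ?_⟩
      ext t
      simp [evalAway_algebraMap]
    · rintro ⟨S, rfl⟩
      -- Denominators are cleared: a fraction is replaced by its possible numerators, which have the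
      -- same zeros where `f` does not vanish.
      refine ⟨{t | ∀ a ∈ {a : A | ∃ b ∈ S, ∃ n : ℕ, algebraMap A _ a = b * algebraMap A _ (f ^ n)},
        ev a t = 0}, (h.isClosed_iff _).2 ⟨_, rfl⟩, ?_⟩
      ext t
      simp only [Set.mem_preimage, Set.mem_ofPred_eq]
      constructor
      · intro ht b hb
        obtain ⟨⟨a, ⟨_, n, rfl⟩⟩, hab⟩ := IsLocalization.surj (Submonoid.powers f) b
        have h0 := ht a ⟨b, hb, n, hab.symm⟩
        rw [← evalAway_algebraMap, ← hab] at h0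
        simp only [map_mul, Pi.mul_apply, evalAway_algebraMap, mul_eq_zero] at h0
        refine h0.resolve_right ?_
        rw [map_pow]
        exact pow_ne_zero n t.2
      · rintro ht a ⟨b, hb, n, hab⟩
        rw [← evalAway_algebraMap, hab, map_mul, Pi.mul_apply, ht b hb, zero_mul]
  · intro φ
    obtain ⟨t, ht⟩ := h.exists_eval (φ.comp (IsScalarTower.toAlgHom K A (Localization.Away f)))
    have ht' : ∀ a, φ (algebraMap A _ a) = ev a t := ht
    have htf : ev f t ≠ 0 := by
      rw [← ht']
      exact ((IsLocalization.Away.algebraMap_isUnit f).map φ).ne_zero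
    refine ⟨⟨t, htf⟩, fun b => ?_⟩
    have : φ.toRingHom = (Pi.evalRingHom (fun _ => K) (⟨t, htf⟩ : {t | ev f t ≠ 0})).comp
        (evalAway ev f).toRingHom := by
      refine IsLocalization.ringHom_ext (Submonoid.powers f) ?_
      ext a
      exact (ht' a).trans (evalAway_algebraMap ev f a ⟨t, htf⟩).symm
    exact congrArg (fun ψ : Localization.Away f →+* K => ψ b) this

/-- A nonempty open set contains the nonvanishing locus of some `f ≠ 0`, whose ring `A_f` has the
same dimension as `A`. -/
theorem IsAffineModel.isEquidim {K T A : Type*} [Field K] [IsAlgClosed K] [TopologicalSpace T]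
    [CommRing A] [IsDomain A] [Algebra K A] [Algebra.FiniteType K A] {ev : A →ₐ[K] (T → K)}
    (h : IsAffineModel ev) {n : ℕ} (hn : ringKrullDim A = n) : IsEquidim (Set.univ : Set T) n := by
  rintro U hU ⟨t, -, ht⟩
  rw [Set.univ_inter]
  refine le_antisymm ((topologicalKrullDim_subspace_le T U).trans ?_) ?_
  · rw [h.topologicalKrullDim_eq, hn]
  · obtain ⟨S, hS⟩ := (h.isClosed_iff _).1 hU.isClosed_compl
    have : t ∉ Uᶜ := fun h => h ht
    rw [hS] at this
    simp only [Set.mem_ofPred_eq, not_forall] at this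
    obtain ⟨f, hf, hft⟩ := this
    have hsub : {t | ev f t ≠ 0} ⊆ U := by
      intro x hx
      by_contra hxU
      have : x ∈ Uᶜ := hxU
      rw [hS] at this
      exact hx (this f hf)
    have hf0 : f ≠ 0 := by
      rintro rfl
      exact hft (by simp)
    have : Algebra.FiniteType A (Localization.Away f) :=
      IsLocalization.finiteType_of_monoid_fg (Submonoid.powers f) _
    have : Algebra.FiniteType K (Localization.Away f) :=
      Algebra.FiniteType.trans (S := A) inferInstance inferInstance
    refine le_trans ?_ (topologicalKrullDim_mono hsub)
    rw [(h.away f).topologicalKrullDim_eq, ringKrullDim_localizationAway K hf0, hn]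

/-! ### Coordinate rings of closed affine sets and of their products with affine spaces -/

theorem isAffineModel_of_surjective {K ι A : Type*} [Field K] [CommRing A] [Algebra K A]
    {V : Set (ι → K)} {ev : A →ₐ[K] (V → K)} {ψ : MvPolynomial ι K →ₐ[K] A}
    (hψ : Function.Surjective ψ) (hev : ∀ i (v : V), ev (ψ (X i)) v = v.1 i)
    (hpt : ∀ φ : A →ₐ[K] K, ∃ t, ∀ a, φ a = ev a t) : IsAffineModel ev := by
  refine ⟨fun Z => ?_, hpt⟩
  have hev' : ∀ F (v : V), ev (ψ F) v = eval v.1 F := by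
    intro F v
    have : (Pi.evalAlgHom K (fun _ : V => K) v).comp (ev.comp ψ) = aeval v.1 := by
      ext i
      simpa using hev i v
    simpa [coe_aeval_eq_eval] using DFunLike.congr_fun this F
  rw [isClosed_induced_iff]
  constructor
  · rintro ⟨C, hC, rfl⟩
    obtain ⟨S, rfl⟩ := isClosed_affine_iff.1 hC
    refine ⟨ψ '' S, ?_⟩
    ext v
    simp [hev']
  · rintro ⟨S, rfl⟩
    refine ⟨{x | ∀ F ∈ ψ ⁻¹' S, eval x F = 0}, isClosed_affine_iff.2 ⟨_, rfl⟩, ?_⟩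
    ext v
    simp only [Set.mem_preimage, Set.mem_ofPred_eq]
    constructor
    · intro hv a ha
      obtain ⟨F, rfl⟩ := hψ a
      rw [hev', hv F ha]
    · intro hv F hF
      rw [← hev', hv _ hF]

theorem isPrime_vanishingIdeal {K ι : Type*} [Field K] {V : Set (ι → K)} (hV : IsIrreducible V) :
    (vanishingIdeal K V).IsPrime := by
  refine ⟨fun h => ?_, ?_⟩
  · obtain ⟨v, hv⟩ := hV.1
    have := (Ideal.eq_top_iff_one _).1 h v hv
    simp at this
  · intro F G hFG
    by_contra! hcon
    simp only [mem_vanishingIdeal_iff, not_forall] at hcon hFG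
    obtain ⟨⟨x, hx, hxF⟩, y, hy, hyG⟩ := hcon
    obtain ⟨z, hz, hzF, hzG⟩ := hV.2 _ _ (isClosed_zeros F).isOpen_compl
      (isClosed_zeros G).isOpen_compl ⟨x, hx, hxF⟩ ⟨y, hy, hyG⟩
    have := hFG z hz
    rw [map_mul, mul_eq_zero] at this
    exact this.elim hzF hzG

/-- The evaluation of elements of the coordinate ring of an affine set. -/
def evalQuotient {K ι : Type*} [Field K] (V : Set (ι → K)) :
    (MvPolynomial ι K ⧸ vanishingIdeal K V) →ₐ[K] (V → K) :=
  Ideal.Quotient.liftₐ _ (AlgHom.pi (A := fun _ : V => K) fun v => aeval v.1) (by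
    intro F hF
    ext v
    exact hF v.1 v.2)

theorem evalQuotient_mk {K ι : Type*} [Field K] (V : Set (ι → K)) (F : MvPolynomial ι K) (v : V) :
    evalQuotient V (Ideal.Quotient.mk _ F) v = eval v.1 F := by
  rw [← coe_aeval_eq_eval]
  rfl

/-- The images of the coordinates form a point, which satisfies the equations of `V` because these
lie in the vanishing ideal. -/
theorem exists_evalQuotient {K ι : Type*} [Field K] {V : Set (ι → K)} (hV : IsClosed V)
    (φ : (MvPolynomial ι K ⧸ vanishingIdeal K V) →ₐ[K] K) :
    ∃ t, ∀ a, φ a = evalQuotient V a t := by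
  let x : ι → K := fun i => φ (Ideal.Quotient.mk _ (X i))
  have hx : ∀ F, φ (Ideal.Quotient.mk _ F) = eval x F := by
    intro F
    have : φ.comp (Ideal.Quotient.mkₐ K (vanishingIdeal K V)) = aeval x := by
      ext i
      simp [x]
    simpa [coe_aeval_eq_eval] using DFunLike.congr_fun this F
  have hxV : x ∈ V := by
    obtain ⟨S, hS⟩ := isClosed_affine_iff.1 hV
    rw [hS]
    intro F hF
    rw [← hx, Ideal.Quotient.eq_zero_iff_mem.2, map_zero]
    intro v hv
    rw [hS] at hv
    simpa [coe_aeval_eq_eval] using hv F hF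
  refine ⟨⟨x, hxV⟩, fun a => ?_⟩
  obtain ⟨F, rfl⟩ := Ideal.Quotient.mk_surjective a
  rw [hx, evalQuotient_mk]

theorem isAffineModel_evalQuotient {K ι : Type*} [Field K] {V : Set (ι → K)} (hV : IsClosed V) :
    IsAffineModel (evalQuotient V) :=
  isAffineModel_of_surjective (ψ := Ideal.Quotient.mkₐ K _) Ideal.Quotient.mk_surjective
    (fun i v => by simp [evalQuotient_mk]) (exists_evalQuotient hV)

theorem isEquidim_of_univ {T : Type*} [TopologicalSpace T] {V : Set T} {n : ℕ}
    (h : IsEquidim (Set.univ : Set V) n) : IsEquidim V n := by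
  have := (isEquidim_image_iff IsEmbedding.subtypeVal).2 h
  rwa [Set.image_univ, Subtype.range_coe] at this

theorem exists_ringKrullDim_eq_natCast (K A : Type*) [Field K] [CommRing A] [IsDomain A]
    [Algebra K A] [Algebra.FiniteType K A] : ∃ n : ℕ, ringKrullDim A = n :=
  ⟨_, ringKrullDim_eq_toNat_trdeg K A⟩

theorem exists_isEquidim_affine {K ι : Type*} [Field K] [IsAlgClosed K] [Finite ι]
    {V : Set (ι → K)} (hV : IsClosed V) (hirr : IsIrreducible V) : ∃ n, IsEquidim V n := by
  have := isPrime_vanishingIdeal hirr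
  obtain ⟨n, hn⟩ := exists_ringKrullDim_eq_natCast K (MvPolynomial ι K ⧸ vanishingIdeal K V)
  exact ⟨n, isEquidim_of_univ ((isAffineModel_evalQuotient hV).isEquidim hn)⟩

/-- The product of the affine hyperplane `x c = 1` and an affine set. -/
def hyperplaneProd {K ι κ : Type*} [Field K] (c : ι) (V : Set (κ → K)) : Set (ι ⊕ κ → K) :=
  {w | w (.inl c) = 1 ∧ w ∘ .inr ∈ V}

/-- The coordinate ring is a polynomial ring over that of `V`, with one variable for each coordinate
other than `c`; over a Noetherian ring each variable adds one to the dimension. -/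
theorem isEquidim_hyperplaneProd {K ι κ : Type*} [Field K] [IsAlgClosed K] [Fintype ι] [Finite κ]
    {V : Set (κ → K)} (hV : IsClosed V) (hirr : IsIrreducible V) {n : ℕ} (hn : IsEquidim V n)
    (c : ι) : IsEquidim (hyperplaneProd c V) (n + (Fintype.card ι - 1)) := by
  classical
  have := isPrime_vanishingIdeal hirr
  let A := MvPolynomial κ K ⧸ vanishingIdeal K V
  have hA : ringKrullDim A = n := by
    rw [← (isAffineModel_evalQuotient hV).topologicalKrullDim_eq, hn.topologicalKrullDim_eq hirr.1]
  let A' := MvPolynomial {i : ι // i ≠ c} A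
  have hA' : ringKrullDim A' = (n + (Fintype.card ι - 1) : ℕ) := by
    rw [MvPolynomial.ringKrullDim_of_isNoetherianRing, hA, Nat.card_eq_fintype_card,
      Fintype.card_subtype_compl, Fintype.card_subtype_eq]
    push_cast
    rfl
  let ψ : MvPolynomial (ι ⊕ κ) K →ₐ[K] A' := aeval (Sum.elim
    (fun i => if h : i = c then 1 else X ⟨i, h⟩) fun l => C (Ideal.Quotient.mk _ (X l)))
  let pr : hyperplaneProd c V → V := fun w => ⟨w.1 ∘ .inr, w.2.2⟩
  let ev : A' →ₐ[K] (hyperplaneProd c V → K) := AlgHom.pi (A := fun _ => K) fun w =>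
    { eval₂Hom ((Pi.evalRingHom (fun _ => K) (pr w)).comp (evalQuotient V).toRingHom)
        (fun i : {i : ι // i ≠ c} => w.1 (.inl i)) with
      commutes' := fun r => by
        change eval₂Hom _ _ (C (algebraMap K A r)) = _
        rw [eval₂Hom_C]
        exact congrFun ((evalQuotient V).commutes r) (pr w) }
  have hevC : ∀ a w, ev (C a) w = evalQuotient V a (pr w) := fun a w => eval₂Hom_C _ _ _
  have hevX : ∀ i w, ev (X i) w = w.1 (.inl i.1) := fun i w => eval₂Hom_X' _ _ _
  refine isEquidim_of_univ (IsAffineModel.isEquidim (A := A') (ev := ev) ?_ hA')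
  refine isAffineModel_of_surjective (ψ := ψ) ?_ ?_ ?_
  · rw [← AlgHom.range_eq_top, eq_top_iff]
    have hC : ∀ a : A, C a ∈ ψ.range := by
      intro a
      obtain ⟨F, rfl⟩ := Ideal.Quotient.mk_surjective a
      refine ⟨rename .inr F, ?_⟩
      have : (ψ.comp (rename .inr)) =
          (IsScalarTower.toAlgHom K A A').comp (Ideal.Quotient.mkₐ K (vanishingIdeal K V)) := by
        refine MvPolynomial.algHom_ext fun l => ?_
        simp only [ψ, AlgHom.comp_apply, rename_X, aeval_X, Sum.elim_inr]
        rfl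
      exact DFunLike.congr_fun this F
    have hX : ∀ i, X i ∈ ψ.range := fun i => ⟨X (.inl i.1), by simp [ψ, i.2]⟩
    intro F _
    induction F using MvPolynomial.induction_on with
    | C a => exact hC a
    | add p q hp hq => exact add_mem (hp trivial) (hq trivial)
    | mul_X p i hp => exact mul_mem (hp trivial) (hX i)
  · rintro (i | l) w
    · by_cases h : i = c
      · subst h
        simp [ψ, w.2.1]
      · simp [ψ, h, hevX]
    · simp [ψ, hevC, evalQuotient_mk, pr]
  · intro φ
    obtain ⟨t, ht⟩ := exists_evalQuotient hV (φ.comp (IsScalarTower.toAlgHom K A A'))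
    have ht' : ∀ a, φ (C a) = evalQuotient V a t := ht
    let w : ι ⊕ κ → K := Sum.elim (fun i => if h : i = c then 1 else φ (X ⟨i, h⟩)) t.1
    refine ⟨⟨w, by simp [w], by simp [w]⟩, fun F => ?_⟩
    induction F using MvPolynomial.induction_on with
    | C a => rw [ht', hevC]; rfl
    | add p q hp hq => rw [map_add, map_add, hp, hq]; rfl
    | mul_X p i hp =>
      rw [map_mul, map_mul, hp, Pi.mul_apply, hevX]
      simp [w, i.2]

/-! ### Algebras of functions with closed zero sets -/

/-- The zero sets of the functions of the algebra `𝒜` are closed. -/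
def HasClosedZeros {K T : Type*} [Field K] [TopologicalSpace T] (𝒜 : Subalgebra K (T → K)) : Prop :=
  ∀ f ∈ 𝒜, IsClosed {t | f t = 0}

theorem eval_mem_subalgebra {K T ι : Type*} [Field K] {𝒜 : Subalgebra K (T → K)} {φ : T → ι → K}
    (hφ : ∀ i, (fun t => φ t i) ∈ 𝒜) (F : MvPolynomial ι K) : (fun t => eval (φ t) F) ∈ 𝒜 := by
  induction F using MvPolynomial.induction_on with
  | C a => simp only [eval_C]; exact 𝒜.algebraMap_mem a
  | add p q hp hq => simp only [map_add]; exact add_mem hp hq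
  | mul_X p i hp => simp only [map_mul, eval_X]; exact mul_mem hp (hφ i)

/-- Polynomials in members of `𝒜` stay in `𝒜`, so the preimage of an algebraic set is an
intersection of closed zero sets. This handles polynomial and rational maps alike. -/
theorem continuous_affine {K T ι : Type*} [Field K] [TopologicalSpace T] {𝒜 : Subalgebra K (T → K)}
    (h𝒜 : HasClosedZeros 𝒜) {φ : T → ι → K} (hφ : ∀ i, (fun t => φ t i) ∈ 𝒜) : Continuous φ := by
  rw [continuous_iff_isClosed]
  intro Z hZ
  obtain ⟨S, rfl⟩ := isClosed_affine_iff.1 hZ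
  have : φ ⁻¹' {x | ∀ F ∈ S, eval x F = 0} = ⋂ F ∈ S, {t | eval (φ t) F = 0} := by
    ext t
    simp
  rw [this]
  exact isClosed_biInter fun F _ => h𝒜 _ (eval_mem_subalgebra hφ F)

/-! ### Homogeneous equations and maps to projective space -/

theorem isClosed_projective_iff {K ι : Type*} [Field K] {Z : Set (ℙ K (ι → K))} :
    IsClosed Z ↔ IsAlgebraicSet Z := by
  rw [← isOpen_compl_iff]
  change IsAlgebraicSet Zᶜᶜ ↔ _
  rw [compl_compl]

theorem IsHomogeneous.eval_smul {K ι : Type*} [Field K] {F : MvPolynomial ι K} {d : ℕ}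
    (hF : F.IsHomogeneous d) (t : K) (x : ι → K) : eval (t • x) F = t ^ d * eval x F := by
  rw [eval_eq, eval_eq, Finset.mul_sum]
  refine Finset.sum_congr rfl fun m hm => ?_
  have hdeg : d = ∑ i ∈ m.support, m i := hF.degree_eq_sum_deg_support hm
  simp only [Pi.smul_apply, smul_eq_mul, mul_pow, Finset.prod_mul_distrib]
  rw [Finset.prod_pow_eq_pow_sum, ← hdeg]
  ring

theorem IsHomogeneous.eval_rep_mk {K ι : Type*} [Field K] {F : MvPolynomial ι K} {d : ℕ}
    (hF : F.IsHomogeneous d) {v : ι → K} (hv : v ≠ 0) :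
    eval (Projectivization.mk K v hv).rep F = 0 ↔ eval v F = 0 := by
  obtain ⟨a, ha⟩ := Projectivization.exists_smul_eq_mk_rep K v hv
  rw [← ha, Units.smul_def, IsHomogeneous.eval_smul hF]
  simp

theorem isClosed_homogeneous_zeros {K ι : Type*} [Field K] {F : MvPolynomial ι K} {d : ℕ}
    (hF : F.IsHomogeneous d) : IsClosed {p : ℙ K (ι → K) | eval p.rep F = 0} :=
  isClosed_projective_iff.2 ⟨{F}, by simpa using ⟨d, hF⟩, by simp⟩

theorem rep_mk_apply_eq_zero {K ι : Type*} [Field K] {v : ι → K} (hv : v ≠ 0) (i : ι) :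
    (Projectivization.mk K v hv).rep i = 0 ↔ v i = 0 := by
  simpa using IsHomogeneous.eval_rep_mk (isHomogeneous_X K i) hv

theorem isOpen_rep_ne_zero {K ι : Type*} [Field K] (i : ι) :
    IsOpen {p : ℙ K (ι → K) | p.rep i ≠ 0} := by
  have := (isClosed_homogeneous_zeros (isHomogeneous_X K i)).isOpen_compl
  simpa [Set.compl_def] using this

theorem continuous_mk {K T ι : Type*} [Field K] [TopologicalSpace T] {𝒜 : Subalgebra K (T → K)}
    (h𝒜 : HasClosedZeros 𝒜) {φ : T → ι → K} (hφ : ∀ i, (fun t => φ t i) ∈ 𝒜)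
    (h0 : ∀ t, φ t ≠ 0) : Continuous fun t => Projectivization.mk K (φ t) (h0 t) := by
  rw [continuous_iff_isClosed]
  intro Z hZ
  obtain ⟨S, hS, rfl⟩ := isClosed_projective_iff.1 hZ
  have : (fun t => Projectivization.mk K (φ t) (h0 t)) ⁻¹' {p | ∀ F ∈ S, eval p.rep F = 0} =
      ⋂ F ∈ S, {t | eval (φ t) F = 0} := by
    ext t
    simp only [Set.mem_preimage, Set.mem_ofPred_eq, Set.mem_iInter]
    refine forall₂_congr fun F hF => ?_
    obtain ⟨d, hd⟩ := hS F hF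
    exact IsHomogeneous.eval_rep_mk hd _
  rw [this]
  exact isClosed_biInter fun F _ => h𝒜 _ (eval_mem_subalgebra hφ F)

/-- The functions on a subset of affine space that are quotients of polynomials. -/
def fractions {K ι : Type*} [Field K] (V : Set (ι → K)) : Subalgebra K (V → K) where
  carrier := {f | ∃ p q : MvPolynomial ι K, ∀ v : V, eval v.1 q ≠ 0 ∧ f v = eval v.1 p / eval v.1 q}
  mul_mem' := by
    rintro f g ⟨p, q, h⟩ ⟨p', q', h'⟩
    refine ⟨p * p', q * q', fun v => ⟨?_, ?_⟩⟩
    · rw [map_mul]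
      exact mul_ne_zero (h v).1 (h' v).1
    · rw [Pi.mul_apply, (h v).2, (h' v).2, map_mul, map_mul, div_mul_div_comm]
  add_mem' := by
    rintro f g ⟨p, q, h⟩ ⟨p', q', h'⟩
    refine ⟨p * q' + q * p', q * q', fun v => ⟨?_, ?_⟩⟩
    · rw [map_mul]
      exact mul_ne_zero (h v).1 (h' v).1
    · rw [Pi.add_apply, (h v).2, (h' v).2, div_add_div _ _ (h v).1 (h' v).1]
      simp
  algebraMap_mem' r := ⟨C r, 1, fun v => by simp⟩

theorem hasClosedZeros_fractions {K ι : Type*} [Field K] (V : Set (ι → K)) :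
    HasClosedZeros (fractions V) := by
  rintro f ⟨p, q, h⟩
  have : {v | f v = 0} = Subtype.val ⁻¹' {x | eval x p = 0} := by
    ext v
    simp [(h v).2, (h v).1]
  rw [this]
  exact (isClosed_zeros p).preimage continuous_subtype_val

theorem eval_mem_fractions {K ι : Type*} [Field K] {V : Set (ι → K)} (p : MvPolynomial ι K) :
    (fun v : V => eval v.1 p) ∈ fractions V :=
  ⟨p, 1, fun v => by simp⟩

theorem coord_mem_fractions {K ι : Type*} [Field K] {V : Set (ι → K)} (i : ι) :
    (fun v : V => v.1 i) ∈ fractions V := by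
  simpa using eval_mem_fractions (V := V) (X i)

theorem inv_mem_fractions {K ι : Type*} [Field K] {V : Set (ι → K)} {f : V → K}
    (hf : f ∈ fractions V) (h0 : ∀ v, f v ≠ 0) : (fun v => (f v)⁻¹) ∈ fractions V := by
  obtain ⟨p, q, h⟩ := hf
  refine ⟨q, p, fun v => ⟨fun hp => h0 v ?_, ?_⟩⟩
  · rw [(h v).2, hp, zero_div]
  · simp only [(h v).2, inv_div]

theorem det_mem_subalgebra {K T n : Type*} [Field K] [Fintype n] [DecidableEq n]
    {𝒜 : Subalgebra K (T → K)} {M : T → Matrix n n K} (hM : ∀ i j, (fun t => M t i j) ∈ 𝒜) :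
    (fun t => (M t).det) ∈ 𝒜 := by
  have : (fun t => (M t).det) = ∑ σ : Equiv.Perm n, (Equiv.Perm.sign σ : ℤ) •
      ∏ i, fun t => M t (σ i) i := by
    ext t
    simp [Matrix.det_apply, Units.smul_def]
  rw [this]
  exact sum_mem fun σ _ => zsmul_mem (prod_mem fun i _ => hM _ _) _

/-! ### The standard charts of projective space -/

/-- The affine hyperplane where the coordinate `i` is `1`. -/
def hyperplane (K : Type*) [Field K] {ι : Type*} (i : ι) : Set (ι → K) := {v | v i = 1}

theorem ne_zero_of_mem_hyperplane {K ι : Type*} [Field K] {i : ι} {v : ι → K}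
    (hv : v ∈ hyperplane K i) : v ≠ 0 := by
  rintro rfl
  exact zero_ne_one hv

theorem isClosed_hyperplane (K : Type*) [Field K] {ι : Type*} (i : ι) :
    IsClosed (hyperplane K i) := by
  convert isClosed_zeros (X i - C 1 : MvPolynomial ι K) using 1
  ext v
  simp [hyperplane, sub_eq_zero]

/-- The chart of projective space where the coordinate `i` does not vanish. -/
def projChart (K : Type*) [Field K] {ι : Type*} (i : ι) (v : hyperplane K i) : ℙ K (ι → K) :=
  Projectivization.mk K v.1 (ne_zero_of_mem_hyperplane v.2)

theorem range_projChart (K : Type*) [Field K] {ι : Type*} (i : ι) :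
    Set.range (projChart K i) = {p | p.rep i ≠ 0} := by
  ext p
  constructor
  · rintro ⟨v, rfl⟩
    rw [Set.mem_ofPred_eq, projChart, Ne, rep_mk_apply_eq_zero]
    rw [show v.1 i = 1 from v.2]
    exact one_ne_zero
  · intro hp
    refine ⟨⟨(p.rep i)⁻¹ • p.rep, inv_mul_cancel₀ hp⟩, ?_⟩
    rw [projChart]
    conv_rhs => rw [← p.mk_rep]
    exact (Projectivization.mk_eq_mk_iff' K _ _ _ _).2 ⟨_, rfl⟩

/-- The component of degree `d` is multiplied by the power of `X i` that raises it to the total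
degree. -/
theorem exists_homogenization {K ι : Type*} [Field K] (i : ι) (f : MvPolynomial ι K) :
    ∃ (d : ℕ) (F : MvPolynomial ι K), F.IsHomogeneous d ∧
      ∀ x : ι → K, x i = 1 → eval x F = eval x f := by
  refine ⟨f.totalDegree, ∑ d ∈ Finset.range (f.totalDegree + 1),
    homogeneousComponent d f * X i ^ (f.totalDegree - d), ?_, ?_⟩
  · refine MvPolynomial.IsHomogeneous.sum _ _ _ fun d hd => ?_
    have := (homogeneousComponent_isHomogeneous d f).mul (isHomogeneous_X_pow (R := K) i (f.totalDegree - d))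
    rwa [Nat.add_sub_cancel' (by simpa [Nat.lt_succ_iff] using hd)] at this
  · intro x hx
    conv_rhs => rw [← sum_homogeneousComponent f]
    simp [hx]

/-- Closed sets of the chart extend to projective space by homogenizing their equations; the
normalized coordinate fixes the scalar and gives injectivity. -/
theorem isOpenEmbedding_projChart (K : Type*) [Field K] {ι : Type*} (i : ι) :
    IsOpenEmbedding (projChart K i) := by
  refine ⟨⟨⟨?_⟩, ?_⟩, ?_⟩
  · rw [TopologicalSpace.ext_iff_isClosed]
    intro Z
    constructor
    · intro hZ
      rw [isClosed_induced_iff] at hZ ⊢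
      obtain ⟨C, hC, rfl⟩ := hZ
      obtain ⟨S, rfl⟩ := isClosed_affine_iff.1 hC
      choose d F hF hFf using exists_homogenization (K := K) i
      refine ⟨{p | ∀ G ∈ F '' S, eval p.rep G = 0}, isClosed_projective_iff.2 ⟨F '' S, ?_, rfl⟩, ?_⟩
      · rintro _ ⟨f, -, rfl⟩
        exact ⟨_, hF f⟩
      · ext v
        simp only [Set.mem_preimage, Set.mem_ofPred_eq, Set.forall_mem_image]
        refine forall₂_congr fun f _ => ?_
        rw [projChart, IsHomogeneous.eval_rep_mk (hF f), hFf f v.1 v.2]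
    · intro hZ
      rw [isClosed_induced_iff] at hZ
      obtain ⟨C, hC, rfl⟩ := hZ
      exact hC.preimage (continuous_mk (hasClosedZeros_fractions _) (coord_mem_fractions ·)
        fun v => ne_zero_of_mem_hyperplane v.2)
  · intro v w hvw
    obtain ⟨a, ha⟩ := (Projectivization.mk_eq_mk_iff' K _ _ _ _).1 hvw
    have h1 := congrFun ha i
    rw [Pi.smul_apply, show w.1 i = 1 from w.2, show v.1 i = 1 from v.2, smul_eq_mul, mul_one] at h1
    ext1
    rw [← ha, h1, one_smul]
  · rw [range_projChart]
    exact isOpen_rep_ne_zero i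

/-! ### Dimension of closed sets through affine charts -/

/-- The part of `Z` in a chart, as a subset of affine space. -/
def chartSet {K ι T : Type*} {B : Set (ι → K)} (f : B → T) (Z : Set T) : Set (ι → K) :=
  Subtype.val '' (f ⁻¹' Z)

theorem isClosed_chartSet {K ι T : Type*} [Field K] [TopologicalSpace T] {B : Set (ι → K)}
    (hB : IsClosed B) {f : B → T} (hf : Continuous f) {Z : Set T} (hZ : IsClosed Z) :
    IsClosed (chartSet f Z) :=
  hB.isClosedEmbedding_subtypeVal.isClosedMap _ (hZ.preimage hf)

theorem isIrreducible_chartSet {K ι T : Type*} [Field K] [TopologicalSpace T] {B : Set (ι → K)}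
    {f : B → T} (hf : IsOpenEmbedding f) {Z : Set T} (hZ : IsIrreducible Z)
    (hne : (Z ∩ Set.range f).Nonempty) : IsIrreducible (chartSet f Z) := by
  rw [chartSet, isIrreducible_image_iff IsInducing.subtypeVal,
    ← isIrreducible_image_iff hf.isInducing, Set.image_preimage_eq_inter_range]
  exact IsIrreducible.inter_isOpen hZ hf.isOpen_range hne

theorem isEquidim_chartSet_iff {K ι T : Type*} [Field K] [TopologicalSpace T] {B : Set (ι → K)}
    {f : B → T} (hf : IsEmbedding f) {Z : Set T} {n : ℕ} :
    IsEquidim (chartSet f Z) n ↔ IsEquidim (Z ∩ Set.range f) n := by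
  rw [chartSet, isEquidim_image_iff IsEmbedding.subtypeVal, ← isEquidim_image_iff hf,
    Set.image_preimage_eq_inter_range]

theorem exists_isEquidim_of_charts {K ι T γ : Type*} [Field K] [IsAlgClosed K] [Finite ι]
    [TopologicalSpace T] {B : γ → Set (ι → K)} (hB : ∀ c, IsClosed (B c)) {f : ∀ c, B c → T}
    (hf : ∀ c, IsOpenEmbedding (f c)) (hcov : ∀ t, ∃ c, t ∈ Set.range (f c)) {Z : Set T}
    (hZ : IsClosed Z) (hirr : IsIrreducible Z) : ∃ n, IsEquidim Z n := by
  refine exists_isEquidim_of_isOpen_cover hirr (fun c => (hf c).isOpen_range) (fun t _ => hcov t)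
    fun c hc => ?_
  obtain ⟨n, hn⟩ := exists_isEquidim_affine (isClosed_chartSet (hB c) (hf c).continuous hZ)
    (isIrreducible_chartSet (hf c) hirr hc)
  exact ⟨n, (isEquidim_chartSet_iff (hf c).isEmbedding).1 hn⟩

theorem exists_rep_ne_zero {K ι : Type*} [Field K] (p : ℙ K (ι → K)) : ∃ i, p.rep i ≠ 0 :=
  Function.ne_iff.1 p.rep_nonzero

theorem exists_isEquidim_projective {K ι : Type*} [Field K] [IsAlgClosed K] [Finite ι]
    {Z : Set (ℙ K (ι → K))} (hZ : IsClosed Z) (hirr : IsIrreducible Z) : ∃ n, IsEquidim Z n :=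
  exists_isEquidim_of_charts (isClosed_hyperplane K) (isOpenEmbedding_projChart K)
    (fun p => by simpa [range_projChart] using exists_rep_ne_zero p) hZ hirr

theorem mem_chartSet_projChart {K ι : Type*} [Field K] {i : ι} {Z : Set (ℙ K (ι → K))}
    {v : ι → K} : v ∈ chartSet (projChart K i) Z ↔
      v i = 1 ∧ ∃ h : v ≠ 0, Projectivization.mk K v h ∈ Z := by
  constructor
  · rintro ⟨w, hw, rfl⟩
    exact ⟨w.2, ne_zero_of_mem_hyperplane w.2, hw⟩
  · rintro ⟨h1, h, hZ⟩
    exact ⟨⟨v, h1⟩, hZ, rfl⟩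

/-! ### Cones -/

/-- The punctured affine cone over a subset of projective space. -/
def cone {K ι : Type*} [Field K] (Z : Set (ℙ K (ι → K))) : Set (ι → K) :=
  {v | ∃ h : v ≠ 0, Projectivization.mk K v h ∈ Z}

theorem smul_mem_cone {K ι : Type*} [Field K] {Z : Set (ℙ K (ι → K))} {v : ι → K}
    (hv : v ∈ cone Z) {t : K} (ht : t ≠ 0) : t • v ∈ cone Z := by
  obtain ⟨h, hZ⟩ := hv
  refine ⟨smul_ne_zero ht h, ?_⟩
  rwa [show Projectivization.mk K (t • v) _ = Projectivization.mk K v h from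
    (Projectivization.mk_eq_mk_iff' K _ _ _ _).2 ⟨t, rfl⟩]

theorem rep_mem_cone {K ι : Type*} [Field K] {Z : Set (ℙ K (ι → K))} {p : ℙ K (ι → K)} (hp : p ∈ Z) :
    p.rep ∈ cone Z :=
  ⟨p.rep_nonzero, by rwa [p.mk_rep]⟩

/-- Along the line through `x`, the coefficients of `f` are the values of its homogeneous components
at `x`. -/
theorem exists_polynomial_eval_smul {K ι : Type*} [Field K] (f : MvPolynomial ι K) (d : ℕ)
    {x : ι → K} (hx : eval x (homogeneousComponent d f) ≠ 0) :
    ∃ P : Polynomial K, P ≠ 0 ∧ ∀ t, P.eval t = eval (t • x) f := by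
  refine ⟨∑ e ∈ Finset.range (f.totalDegree + 1),
    Polynomial.monomial e (eval x (homogeneousComponent e f)), fun h0 => hx ?_, fun t => ?_⟩
  · have hd : d ≤ f.totalDegree := by
      by_contra! hd
      rw [homogeneousComponent_eq_zero _ _ hd, map_zero] at hx
      exact hx rfl
    have := congrArg (fun P => Polynomial.coeff P d) h0
    simpa [Polynomial.coeff_monomial, Nat.lt_succ_iff, hd] using this
  · conv_rhs => rw [← sum_homogeneousComponent f]
    rw [Polynomial.eval_finsetSum, map_sum]
    refine Finset.sum_congr rfl fun e _ => ?_
    rw [IsHomogeneous.eval_smul (homogeneousComponent_isHomogeneous e f), Polynomial.eval_monomial,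
      mul_comm]

/-- If `f` is nonzero somewhere on the cone, then so is one of its homogeneous components, and this
is an open condition on `Z`. Irreducibility gives one point that serves two such conditions, and a
suitable multiple of its representative lies in both open sets. -/
theorem isIrreducible_cone {K ι : Type*} [Field K] [Infinite K] {Z : Set (ℙ K (ι → K))}
    (hZ : IsIrreducible Z) : IsIrreducible (cone Z) := by
  constructor
  · obtain ⟨p, hp⟩ := hZ.1
    exact ⟨_, rep_mem_cone hp⟩
  · have key : ∀ U : Set (ι → K), IsOpen U → (cone Z ∩ U).Nonempty →
        ∃ (f : MvPolynomial ι K) (d : ℕ), {x | eval x f ≠ 0} ⊆ U ∧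
          (Z ∩ {p | eval p.rep (homogeneousComponent d f) = 0}ᶜ).Nonempty := by
      rintro U hU ⟨v, ⟨hv0, hv⟩, hvU⟩
      obtain ⟨S, hS⟩ := isClosed_affine_iff.1 hU.isClosed_compl
      have hvS : v ∉ Uᶜ := fun h => h hvU
      rw [hS] at hvS
      simp only [Set.mem_ofPred_eq, not_forall] at hvS
      obtain ⟨f, hf, hfv⟩ := hvS
      have : ∃ d, eval v (homogeneousComponent d f) ≠ 0 := by
        by_contra! hcon
        apply hfv
        rw [← sum_homogeneousComponent f, map_sum]
        exact Finset.sum_eq_zero fun d _ => hcon d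
      obtain ⟨d, hd⟩ := this
      refine ⟨f, d, fun x hx => ?_, _, hv, ?_⟩
      · by_contra hxU
        have : x ∈ Uᶜ := hxU
        rw [hS] at this
        exact hx (this f hf)
      · rw [Set.mem_compl_iff, Set.mem_ofPred_eq,
          IsHomogeneous.eval_rep_mk (homogeneousComponent_isHomogeneous d f)]
        exact hd
    intro U V hU hV hUne hVne
    obtain ⟨f, d, hfU, hf⟩ := key U hU hUne
    obtain ⟨g, e, hgV, hg⟩ := key V hV hVne
    obtain ⟨p, hp, hpf, hpg⟩ := hZ.2 _ _
      (isClosed_homogeneous_zeros (homogeneousComponent_isHomogeneous d f)).isOpen_compl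
      (isClosed_homogeneous_zeros (homogeneousComponent_isHomogeneous e g)).isOpen_compl hf hg
    obtain ⟨P, hP0, hP⟩ := exists_polynomial_eval_smul f d hpf
    obtain ⟨Q, hQ0, hQ⟩ := exists_polynomial_eval_smul g e hpg
    -- The factor `X` forces `t ≠ 0`, so that the multiple stays in the punctured cone.
    have : ∃ t, (P * Q * Polynomial.X).eval t ≠ 0 := by
      by_contra! hcon
      exact mul_ne_zero (mul_ne_zero hP0 hQ0) Polynomial.X_ne_zero
        (Polynomial.funext fun t => by rw [hcon, Polynomial.eval_zero])
    obtain ⟨t, ht⟩ := this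
    simp only [Polynomial.eval_mul, Polynomial.eval_X, ne_eq, mul_eq_zero, not_or] at ht
    obtain ⟨⟨htP, htQ⟩, ht0⟩ := ht
    exact ⟨t • p.rep, smul_mem_cone (rep_mem_cone hp) ht0, hfU (by rwa [hP] at htP),
      hgV (by rwa [hQ] at htQ)⟩

/-! ### The dimension of Segre products -/

theorem continuous_polynomial {K ι κ : Type*} [Field K] (F : κ → MvPolynomial ι K) :
    Continuous fun (x : ι → K) l => eval x (F l) := by
  let 𝒜 : Subalgebra K ((ι → K) → K) := (AlgHom.pi fun x : ι → K => aeval (R := K) x).range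
  have h𝒜 : HasClosedZeros 𝒜 := by
    rintro _ ⟨G, rfl⟩
    exact isClosed_zeros G
  exact continuous_affine h𝒜 fun l => ⟨F l, rfl⟩

theorem mk_eq_mk_of_smul {K V : Type*} [Field K] [AddCommGroup V] [Module K V] {v w : V}
    (hv : v ≠ 0) (hw : w ≠ 0) {t : K} (h : t • w = v) :
    Projectivization.mk K v hv = Projectivization.mk K w hw :=
  (Projectivization.mk_eq_mk_iff' K _ _ _ _).2 ⟨t, h⟩

theorem segreMap_mk {K ι κ : Type*} [Field K] {a : ι → K} {b : κ → K} (ha : a ≠ 0) (hb : b ≠ 0) :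
    segreMap (Projectivization.mk K a ha) (Projectivization.mk K b hb) =
      Projectivization.mk K (fun ij : ι × κ => a ij.1 * b ij.2) (segre_ne_zero ha hb) := by
  obtain ⟨s, hs⟩ := Projectivization.exists_smul_eq_mk_rep K a ha
  obtain ⟨t, ht⟩ := Projectivization.exists_smul_eq_mk_rep K b hb
  refine mk_eq_mk_of_smul _ _ (t := (s : K) * t) ?_
  ext ij
  rw [← hs, ← ht]
  simp only [Pi.smul_apply, Units.smul_def, smul_eq_mul]
  ring

/-- The Segre map on affine coordinates. -/
def segreAffine {K ι κ : Type*} [Field K] (w : ι ⊕ κ → K) : ι × κ → K :=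
  fun ij => w (.inl ij.1) * w (.inr ij.2)

/-- As both factors are normalized, column `j` of the product is the first factor and row `c` is the
second. -/
theorem isEmbedding_segreAffine {K ι κ : Type*} [Field K] (c : ι) (j : κ) {V : Set (κ → K)}
    (hV : V ⊆ hyperplane K j) :
    IsEmbedding fun w : hyperplaneProd c V => segreAffine w.1 := by
  have h1 : Continuous (segreAffine : (ι ⊕ κ → K) → ι × κ → K) := by
    convert continuous_polynomial (fun ij : ι × κ => (X (.inl ij.1) * X (.inr ij.2) :
      MvPolynomial (ι ⊕ κ) K)) using 3
    simp [segreAffine]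
  have h2 : Continuous (fun (M : ι × κ → K) (l : ι ⊕ κ) =>
      l.elim (fun i => M (i, j)) fun l => M (c, l)) := by
    convert continuous_polynomial (fun l : ι ⊕ κ => (l.elim (fun i => X (i, j)) (fun l => X (c, l)) :
      MvPolynomial (ι × κ) K)) using 3 with M l
    rcases l with i | l <;> simp
  refine IsEmbedding.of_comp (h1.comp continuous_subtype_val) h2 ?_
  convert IsEmbedding.subtypeVal (p := (· ∈ hyperplaneProd c V)) using 1
  ext ⟨w, hw1, hw2⟩ l
  have : w (.inr j) = 1 := hV hw2
  rcases l with i | l <;> simp [segreAffine, this, hw1]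

/-- A rank one matrix with entry `1` at `(c, j)` factors with `c`-th and `j`-th coordinates equal to
`1`. -/
theorem chartSet_segreProduct {K : Type*} [Field K] {r k : ℕ} (X : Set (ℙ K (Fin (r + 1) → K)))
    (c : Fin (k + 1)) (j : Fin (r + 1)) :
    chartSet (projChart K (c, j)) (segreProduct k X) =
      segreAffine '' hyperplaneProd c (chartSet (projChart K j) X) := by
  ext M
  rw [mem_chartSet_projChart]
  constructor
  · rintro ⟨h1, h0, p, -, q, hq, hpq⟩
    obtain ⟨t, ht⟩ := (Projectivization.mk_eq_mk_iff' K _ _ _ _).1 hpq.symm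
    have h2 := congrFun ht (c, j)
    simp only [Pi.smul_apply, smul_eq_mul, h1] at h2
    have hpc : p.rep c ≠ 0 := by
      intro h; simp [h] at h2
    have hqj : q.rep j ≠ 0 := by
      intro h; simp [h] at h2
    refine ⟨Sum.elim ((p.rep c)⁻¹ • p.rep) ((q.rep j)⁻¹ • q.rep), ⟨by simp [hpc], ?_⟩, ?_⟩
    · rw [Sum.elim_comp_inr, mem_chartSet_projChart]
      refine ⟨by simp [hqj], smul_ne_zero (inv_ne_zero hqj) q.rep_nonzero, ?_⟩
      rwa [mk_eq_mk_of_smul _ q.rep_nonzero rfl, q.mk_rep]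
    · rw [← ht]
      ext ij
      simp only [segreAffine, Sum.elim_inl, Sum.elim_inr, Pi.smul_apply, smul_eq_mul]
      field_simp
      linear_combination (-(p.rep ij.1) * q.rep ij.2) * h2
  · rintro ⟨w, ⟨hw1, hw2⟩, rfl⟩
    rw [mem_chartSet_projChart] at hw2
    obtain ⟨hwj, hx, hX⟩ := hw2
    have ha : w ∘ .inl ≠ (0 : Fin (k + 1) → K) := by
      intro h
      have := congrFun h c
      simp [hw1] at this
    refine ⟨?_, segre_ne_zero ha hx, _, trivial, _, hX, segreMap_mk ha hx⟩
    simp only [Function.comp_apply] at hwj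
    simp [segreAffine, hw1, hwj]

theorem isEquidim_range_iff {T T' : Type*} [TopologicalSpace T] [TopologicalSpace T'] {V : Set T}
    {f : T → T'} (hf : IsEmbedding fun v : V => f v.1) {n : ℕ} :
    IsEquidim (f '' V) n ↔ IsEquidim V n := by
  have h1 : f '' V = (fun v : V => f v.1) '' Set.univ := by
    rw [Set.image_univ, Set.image_eq_range]
  have h2 : V = Subtype.val '' (Set.univ : Set V) := by simp
  rw [h1, isEquidim_image_iff hf]
  conv_rhs => rw [h2]
  rw [isEquidim_image_iff IsEmbedding.subtypeVal]

theorem dim_segreProduct {K : Type*} [Field K] [IsAlgClosed K] {r : ℕ} (k : ℕ)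
    {X : Set (ℙ K (Fin (r + 1) → K))} (hX : IsClosed X) (hirr : IsIrreducible X) :
    dim (segreProduct k X) = dim X + k := by
  obtain ⟨n, hn⟩ := exists_isEquidim_projective hX hirr
  rw [hn.dim_eq hirr.1]
  -- In each chart that the Segre product meets, it is a product of an affine space of dimension `k`
  -- and a chart of `X`.
  have key : ∀ (c : Fin (k + 1)) (j : Fin (r + 1)), (X ∩ {p | p.rep j ≠ 0}).Nonempty →
      IsEquidim (segreProduct k X ∩ {p | p.rep (c, j) ≠ 0}) (n + k) := by
    intro c j hne
    rw [← range_projChart] at hne ⊢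
    have hj := isOpenEmbedding_projChart K j
    rw [← isEquidim_chartSet_iff (isOpenEmbedding_projChart K (c, j)).isEmbedding,
      chartSet_segreProduct, isEquidim_range_iff (isEmbedding_segreAffine c j ?_)]
    · convert isEquidim_hyperplaneProd (isClosed_chartSet (isClosed_hyperplane K j) hj.continuous hX)
        (isIrreducible_chartSet hj hirr hne)
        ((isEquidim_chartSet_iff hj.isEmbedding).2 (hn.inter_isOpen hj.isOpen_range)) c using 2
      simp
    · rintro v ⟨w, -, rfl⟩
      exact w.2
  obtain ⟨p, hp⟩ := hirr.1
  obtain ⟨j, hj⟩ := exists_rep_ne_zero p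
  refine dim_eq_of_topologicalKrullDim_eq (le_antisymm ?_ ?_)
  · refine topologicalKrullDim_le_of_isOpen_cover (U := fun c => {p | p.rep c ≠ 0})
      isOpen_rep_ne_zero (fun q _ => exists_rep_ne_zero q) ?_
    rintro ⟨c, l⟩ hne
    refine ((key c l ?_).topologicalKrullDim_eq hne).le
    obtain ⟨_, ⟨p, -, q, hq, rfl⟩, h⟩ := hne
    refine ⟨q, hq, fun h0 => h ?_⟩
    rw [segreMap, rep_mk_apply_eq_zero, h0, mul_zero]
  · rw [← (key 0 j ⟨p, hp, hj⟩).topologicalKrullDim_eq ?_]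
    · exact topologicalKrullDim_mono Set.inter_subset_left
    · have hsingle : (Pi.single 0 1 : Fin (k + 1) → K) ≠ 0 := by simp
      refine ⟨_, ⟨Projectivization.mk K _ hsingle, trivial, p, hp, rfl⟩, ?_⟩
      rw [Set.mem_ofPred_eq]
      nth_rw 1 [← p.mk_rep]
      rw [segreMap_mk, Ne, rep_mk_apply_eq_zero]
      simpa using hj

/-! ### Charts of the Grassmannian -/

/-- The matrix with given entries. -/
def toMatrix {K : Type*} {ι κ : Type*} (M : ι × κ → K) : Matrix ι κ K := fun i j => M (i, j)

theorem minors_apply {K : Type*} [Field K] {k m : ℕ} (v : Matrix (Fin (k + 1)) (Fin (m + 1)) K)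
    (I : Fin (k + 1) ↪o Fin (m + 1)) : minors v.row I = (v.submatrix id I).det := rfl

theorem minors_mul {K : Type*} [Field K] {k m : ℕ} (g : Matrix (Fin (k + 1)) (Fin (k + 1)) K)
    (v : Matrix (Fin (k + 1)) (Fin (m + 1)) K) :
    minors (g * v).row = g.det • minors v.row := by
  ext I
  rw [Pi.smul_apply, minors_apply, minors_apply, smul_eq_mul, ← Matrix.det_mul]
  rfl

theorem linearIndependent_of_det_ne_zero {K : Type*} [Field K] {k m : ℕ}
    {v : Matrix (Fin (k + 1)) (Fin (m + 1)) K} {c : Fin (k + 1) → Fin (m + 1)}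
    (h : (v.submatrix id c).det ≠ 0) : LinearIndependent K v.row := by
  have h1 : LinearIndependent K (v.submatrix id c).row :=
    Matrix.linearIndependent_rows_iff_isUnit.2 ((Matrix.isUnit_iff_isUnit_det _).2 h.isUnit)
  exact LinearIndependent.of_comp (LinearMap.funLeft K K c) h1

theorem linearIndependent_iff_exists_minors {K : Type*} [Field K] {k m : ℕ}
    {v : Matrix (Fin (k + 1)) (Fin (m + 1)) K} :
    LinearIndependent K v.row ↔ ∃ I, minors v.row I ≠ 0 :=
  ⟨fun h => Function.ne_iff.1 (minors_ne_zero h), fun ⟨_, h⟩ => linearIndependent_of_det_ne_zero h⟩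

/-- The row space of a matrix with linearly independent rows. -/
@[simps]
def rowSpace {K : Type*} [Field K] {k m : ℕ} (v : Matrix (Fin (k + 1)) (Fin (m + 1)) K)
    (hv : LinearIndependent K v.row) : Grassmannian K k m where
  toSubmodule := Submodule.span K (Set.range v.row)
  finrank_eq := by rw [finrank_span_eq_card hv, Fintype.card_fin]

theorem mul_row_eq_sum {K : Type*} [Field K] {p q n : Type*} [Fintype q]
    (g : Matrix p q K) (w : Matrix q n K) (i : p) : (g * w).row i = ∑ j, g i j • w.row j := by
  ext l
  simp [Matrix.row, Matrix.mul_apply]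

theorem exists_eq_mul_of_forall_mem_span {K : Type*} [Field K] {p q n : Type*} [Fintype q]
    {v : Matrix p n K} {w : Matrix q n K} (h : ∀ i, v.row i ∈ Submodule.span K (Set.range w.row)) :
    ∃ g : Matrix p q K, v = g * w := by
  choose g hg using fun i => (Submodule.mem_span_range_iff_exists_fun K).1 (h i)
  refine ⟨Matrix.of g, ?_⟩
  ext i j
  have := congrFun ((mul_row_eq_sum (Matrix.of g) w i).trans (hg i)) j
  exact this.symm

theorem mul_row_mem_span {K : Type*} [Field K] {p q n : Type*} [Fintype q]
    (g : Matrix p q K) (w : Matrix q n K) (i : p) :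
    (g * w).row i ∈ Submodule.span K (Set.range w.row) :=
  (Submodule.mem_span_range_iff_exists_fun K).2 ⟨g i, (mul_row_eq_sum g w i).symm⟩

theorem Grassmannian.span_frame {K : Type*} [Field K] {k m : ℕ} (W : Grassmannian K k m) :
    Submodule.span K (Set.range W.frame) = W.toSubmodule := by
  have h : W.frame = W.toSubmodule.subtype ∘ Module.finBasisOfFinrankEq K W.toSubmodule W.finrank_eq :=
    rfl
  rw [h, Set.range_comp, ← Submodule.map_span, Module.Basis.span_eq, Submodule.map_top,
    Submodule.range_subtype]

/-- A matrix whose rows form a basis of the subspace. -/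
def Grassmannian.matrix {K : Type*} [Field K] {k m : ℕ} (W : Grassmannian K k m) :
    Matrix (Fin (k + 1)) (Fin (m + 1)) K := Matrix.of W.frame

theorem Grassmannian.linearIndependent_matrix {K : Type*} [Field K] {k m : ℕ}
    (W : Grassmannian K k m) : LinearIndependent K W.matrix.row := W.linearIndependent_frame

theorem rowSpace_matrix {K : Type*} [Field K] {k m : ℕ} (W : Grassmannian K k m) :
    rowSpace W.matrix W.linearIndependent_matrix = W :=
  Grassmannian.ext W.span_frame

theorem Grassmannian.plucker_eq {K : Type*} [Field K] {k m : ℕ} (W : Grassmannian K k m) :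
    W.plucker = Projectivization.mk K (minors W.matrix.row)
      (minors_ne_zero W.linearIndependent_matrix) := rfl

/-- The basis chosen in `Grassmannian.frame` differs from `v` by a square matrix, which scales all
the minors by its determinant. -/
theorem plucker_rowSpace {K : Type*} [Field K] {k m : ℕ} {v : Matrix (Fin (k + 1)) (Fin (m + 1)) K}
    (hv : LinearIndependent K v.row) :
    (rowSpace v hv).plucker = Projectivization.mk K (minors v.row) (minors_ne_zero hv) := by
  obtain ⟨g, hg⟩ := exists_eq_mul_of_forall_mem_span (v := (rowSpace v hv).matrix) (w := v)
    (fun i => by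
      have : (rowSpace v hv).matrix.row i ∈ (rowSpace v hv).toSubmodule := by
        rw [← (rowSpace v hv).span_frame]
        exact Submodule.subset_span ⟨i, rfl⟩
      exact this)
  rw [Grassmannian.plucker_eq]
  refine mk_eq_mk_of_smul _ _ (t := g.det) ?_
  rw [hg, minors_mul]

theorem rowSpace_eq_of_mul {K : Type*} [Field K] {k m : ℕ}
    {v w : Matrix (Fin (k + 1)) (Fin (m + 1)) K} {g : Matrix (Fin (k + 1)) (Fin (k + 1)) K}
    (hv : LinearIndependent K v.row) (hw : LinearIndependent K w.row) (h : v = g * w) :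
    rowSpace v hv = rowSpace w hw := by
  ext1
  refine Submodule.eq_of_le_of_finrank_eq ?_
    ((rowSpace v hv).finrank_eq.trans (rowSpace w hw).finrank_eq.symm)
  rw [rowSpace_toSubmodule, Submodule.span_le]
  rintro _ ⟨i, rfl⟩
  rw [h]
  exact mul_row_mem_span g w i

/-- Plücker coordinates are indexed by increasing columns only; other orders cost a sign, and
repeated columns give zero. Unsorted columns arise below when one column of `I` is replaced. -/
theorem exists_polynomial_minor {K : Type*} [Field K] {k m : ℕ} (c : Fin (k + 1) → Fin (m + 1)) :
    ∃ F : MvPolynomial (Fin (k + 1) ↪o Fin (m + 1)) K,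
      ∀ v : Matrix (Fin (k + 1)) (Fin (m + 1)) K, eval (minors v.row) F = (v.submatrix id c).det := by
  by_cases hc : Function.Injective c
  · let σ := Tuple.sort c
    have hmono : StrictMono (c ∘ σ) :=
      (Tuple.monotone_sort c).strictMono_of_injective (hc.comp σ.injective)
    let I : Fin (k + 1) ↪o Fin (m + 1) := OrderEmbedding.ofStrictMono _ hmono
    refine ⟨C ((Equiv.Perm.sign σ : ℤ) : K) * X I, fun v => ?_⟩
    rw [map_mul, eval_C, eval_X, minors_apply]
    have h1 : v.submatrix id I = (v.submatrix id c).submatrix id σ := rfl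
    rw [h1, Matrix.det_permute', ← mul_assoc, ← Int.cast_mul, ← Units.val_mul, Int.units_mul_self]
    simp
  · refine ⟨0, fun v => ?_⟩
    simp only [Function.Injective, not_forall] at hc
    obtain ⟨a, b, hab, hne⟩ := hc
    rw [map_zero]
    exact (Matrix.det_zero_of_column_eq hne fun i => by simp [hab]).symm

/-- The matrices whose submatrix with columns `I` is the identity. -/
def grassmannCell (K : Type*) [Field K] {k m : ℕ} (I : Fin (k + 1) ↪o Fin (m + 1)) :
    Set (Fin (k + 1) × Fin (m + 1) → K) :=
  {N | (toMatrix N).submatrix id I = 1}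

theorem isClosed_grassmannCell (K : Type*) [Field K] {k m : ℕ} (I : Fin (k + 1) ↪o Fin (m + 1)) :
    IsClosed (grassmannCell K I) := by
  refine isClosed_affine_iff.2 ⟨Set.range fun ab : Fin (k + 1) × Fin (k + 1) =>
    X (ab.1, I ab.2) - C ((1 : Matrix (Fin (k + 1)) (Fin (k + 1)) K) ab.1 ab.2), ?_⟩
  ext N
  simp only [grassmannCell, Set.mem_ofPred_eq, Set.forall_mem_range, ← Matrix.ext_iff, Prod.forall]
  simp [sub_eq_zero, toMatrix]

theorem linearIndependent_of_mem_grassmannCell {K : Type*} [Field K] {k m : ℕ}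
    {I : Fin (k + 1) ↪o Fin (m + 1)} {N : Fin (k + 1) × Fin (m + 1) → K}
    (hN : N ∈ grassmannCell K I) : LinearIndependent K (toMatrix N).row :=
  linearIndependent_of_det_ne_zero (c := I) (by
    rw [show (toMatrix N).submatrix id I = 1 from hN, Matrix.det_one]
    exact one_ne_zero)

/-- The chart of the Grassmannian belonging to the columns `I`. -/
def grassmannChart (K : Type*) [Field K] {k m : ℕ} (I : Fin (k + 1) ↪o Fin (m + 1))
    (N : grassmannCell K I) : Grassmannian K k m :=
  rowSpace (toMatrix N.1) (linearIndependent_of_mem_grassmannCell N.2)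

theorem continuous_plucker (K : Type*) [Field K] (k m : ℕ) :
    Continuous (Grassmannian.plucker : Grassmannian K k m → _) := continuous_induced_dom

theorem continuous_rowSpace {K T : Type*} [Field K] [TopologicalSpace T] {k m : ℕ}
    {𝒜 : Subalgebra K (T → K)} (h𝒜 : HasClosedZeros 𝒜)
    {v : T → Matrix (Fin (k + 1)) (Fin (m + 1)) K} (hv : ∀ i j, (fun t => v t i j) ∈ 𝒜)
    (hli : ∀ t, LinearIndependent K (v t).row) : Continuous fun t => rowSpace (v t) (hli t) := by
  refine continuous_induced_rng.2 ?_
  have : Grassmannian.plucker ∘ (fun t => rowSpace (v t) (hli t)) =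
      fun t => Projectivization.mk K (minors (v t).row) (minors_ne_zero (hli t)) :=
    funext fun t => plucker_rowSpace (hli t)
  rw [this]
  exact continuous_mk h𝒜 (φ := fun t => minors (v t).row) (fun J => det_mem_subalgebra (M := fun t => (v t).submatrix id J) fun i j => hv i (J j)) _

theorem range_grassmannChart (K : Type*) [Field K] {k m : ℕ} (I : Fin (k + 1) ↪o Fin (m + 1)) :
    Set.range (grassmannChart K I) = {W | W.plucker.rep I ≠ 0} := by
  ext W
  constructor
  · rintro ⟨N, rfl⟩
    rw [Set.mem_ofPred_eq, grassmannChart, plucker_rowSpace, Ne, rep_mk_apply_eq_zero, minors_apply,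
      show (toMatrix N.1).submatrix id I = 1 from N.2, Matrix.det_one]
    exact one_ne_zero
  · intro hW
    rw [Set.mem_ofPred_eq, Grassmannian.plucker_eq, Ne, rep_mk_apply_eq_zero, minors_apply] at hW
    let F : Matrix (Fin (k + 1)) (Fin (m + 1)) K := W.matrix
    let N : Matrix (Fin (k + 1)) (Fin (m + 1)) K := (F.submatrix id I)⁻¹ * F
    have hN : (fun ij : Fin (k + 1) × Fin (m + 1) => N ij.1 ij.2) ∈ grassmannCell K I := by
      change (F.submatrix id I)⁻¹ * F.submatrix id I = 1
      exact Matrix.nonsing_inv_mul _ (Ne.isUnit hW)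
    refine ⟨⟨_, hN⟩, ?_⟩
    exact (rowSpace_eq_of_mul (g := (F.submatrix id I)⁻¹) _ W.linearIndependent_matrix rfl).trans
      (rowSpace_matrix W)

theorem minors_of_mem_grassmannCell {K : Type*} [Field K] {k m : ℕ}
    {I : Fin (k + 1) ↪o Fin (m + 1)} {N : Fin (k + 1) × Fin (m + 1) → K}
    (hN : N ∈ grassmannCell K I) : minors (toMatrix N).row I = 1 := by
  rw [minors_apply, show (toMatrix N).submatrix id I = 1 from hN, Matrix.det_one]

/-- Replacing one column of the identity turns the minor into a single entry, by Cramer's rule. -/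
theorem det_submatrix_update {K : Type*} [Field K] {k m : ℕ}
    {I : Fin (k + 1) ↪o Fin (m + 1)} {N : Fin (k + 1) × Fin (m + 1) → K}
    (hN : N ∈ grassmannCell K I) (a : Fin (k + 1)) (l : Fin (m + 1)) :
    ((toMatrix N).submatrix id (Function.update I a l)).det = N (a, l) := by
  have h1 : (toMatrix N).submatrix id (Function.update I a l) =
      Matrix.updateCol 1 a fun i => N (i, l) := by
    rw [← show (toMatrix N).submatrix id I = 1 from hN]
    ext i j
    by_cases hj : j = a
    · subst hj; simp [toMatrix]
    · simp [hj, toMatrix]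
  rw [h1, ← Matrix.cramer_apply, Matrix.cramer_one]
  rfl

/-- The maximal minors, as a map to an affine chart of the Plücker space. -/
def cellMinors {K : Type*} [Field K] {k m : ℕ} (I : Fin (k + 1) ↪o Fin (m + 1))
    (N : grassmannCell K I) : hyperplane K I :=
  ⟨minors (toMatrix N.1).row, minors_of_mem_grassmannCell N.2⟩

/-- The entries of the matrix are themselves minors up to sign, so the inverse is polynomial in the
Plücker coordinates. -/
theorem isEmbedding_cellMinors {K : Type*} [Field K] {k m : ℕ} (I : Fin (k + 1) ↪o Fin (m + 1)) :
    IsEmbedding (cellMinors (K := K) I) := by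
  have hcont : Continuous (cellMinors (K := K) I) := Continuous.subtype_mk (continuous_affine
    (φ := fun N : grassmannCell K I => minors (toMatrix N.1).row)
    (hasClosedZeros_fractions _) fun J => det_mem_subalgebra
      (M := fun N : grassmannCell K I => (toMatrix N.1).submatrix id J) fun i j =>
      coord_mem_fractions (i, J j)) _
  choose F hF using fun c => exists_polynomial_minor (K := K) (k := k) (m := m) c
  have h : (fun (w : hyperplane K I) (al : Fin (k + 1) × Fin (m + 1)) =>
      eval w.1 (F (Function.update I al.1 al.2))) ∘ cellMinors I = Subtype.val := by
    funext N al
    rw [Function.comp_apply, cellMinors, hF]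
    exact det_submatrix_update N.2 al.1 al.2
  refine IsEmbedding.of_comp hcont ((continuous_polynomial
    fun al : Fin (k + 1) × Fin (m + 1) => F (Function.update I al.1 al.2)).comp
      continuous_subtype_val) ?_
  change IsEmbedding ((fun (w : hyperplane K I) (al : Fin (k + 1) × Fin (m + 1)) =>
      eval w.1 (F (Function.update I al.1 al.2))) ∘ cellMinors I)
  rw [h]
  exact IsEmbedding.subtypeVal

theorem isOpenEmbedding_grassmannChart (K : Type*) [Field K] {k m : ℕ}
    (I : Fin (k + 1) ↪o Fin (m + 1)) : IsOpenEmbedding (grassmannChart K I) := by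
  have hcont : Continuous (grassmannChart K I) :=
    continuous_rowSpace (v := fun N : grassmannCell K I => toMatrix N.1)
      (hasClosedZeros_fractions _) (fun i j => coord_mem_fractions (i, j)) _
  refine ⟨IsEmbedding.of_comp hcont (continuous_plucker K k m) ?_, ?_⟩
  · have hu : Grassmannian.plucker ∘ grassmannChart K I = projChart K I ∘ cellMinors I :=
      funext fun N => plucker_rowSpace _
    rw [hu]
    exact (isOpenEmbedding_projChart K I).isEmbedding.comp (isEmbedding_cellMinors I)
  · rw [range_grassmannChart]
    exact (isOpen_rep_ne_zero I).preimage (continuous_plucker K k m)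

theorem exists_isEquidim_grassmannian {K : Type*} [Field K] [IsAlgClosed K] {k m : ℕ}
    {Z : Set (Grassmannian K k m)} (hZ : IsClosed Z) (hirr : IsIrreducible Z) :
    ∃ n, IsEquidim Z n :=
  exists_isEquidim_of_charts (isClosed_grassmannCell K) (isOpenEmbedding_grassmannChart K)
    (fun W => by simpa [range_grassmannChart] using exists_rep_ne_zero W.plucker) hZ hirr

/-! ### The parameter space of the secant varieties -/

theorem isIrreducible_univ_affine (K ι : Type*) [Field K] [Infinite K] :
    IsIrreducible (Set.univ : Set (ι → K)) := by
  refine ⟨⟨0, trivial⟩, ?_⟩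
  have key : ∀ U : Set (ι → K), IsOpen U → U.Nonempty →
      ∃ f : MvPolynomial ι K, f ≠ 0 ∧ {x | eval x f ≠ 0} ⊆ U := by
    rintro U hU ⟨v, hv⟩
    obtain ⟨S, hS⟩ := isClosed_affine_iff.1 hU.isClosed_compl
    have hvS : v ∉ Uᶜ := fun h => h hv
    rw [hS] at hvS
    simp only [Set.mem_ofPred_eq, not_forall] at hvS
    obtain ⟨f, hf, hfv⟩ := hvS
    refine ⟨f, by rintro rfl; simp at hfv, fun x hx => ?_⟩
    by_contra hxU
    have : x ∈ Uᶜ := hxU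
    rw [hS] at this
    exact hx (this f hf)
  intro U V hU hV hUne hVne
  rw [Set.univ_inter] at hUne hVne ⊢
  obtain ⟨f, hf, hfU⟩ := key U hU hUne
  obtain ⟨g, hg, hgV⟩ := key V hV hVne
  have : ∃ x, eval x (f * g) ≠ 0 := by
    by_contra! hcon
    exact mul_ne_zero hf hg (MvPolynomial.funext fun x => by rw [hcon, map_zero])
  obtain ⟨x, hx⟩ := this
  rw [map_mul, mul_ne_zero_iff] at hx
  exact ⟨x, hfU hx.1, hgV hx.2⟩

section Parameters

variable {K : Type*} [Field K] {k r s : ℕ}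

/-- The matrix of the coefficient vectors. -/
def coefMatrix (e : Fin s × (Fin (k + 1) ⊕ Fin (r + 1)) → K) : Matrix (Fin s) (Fin (k + 1)) K :=
  fun i a => e (i, .inl a)

/-- The matrix of the points. -/
def pointMatrix (e : Fin s × (Fin (k + 1) ⊕ Fin (r + 1)) → K) : Matrix (Fin s) (Fin (r + 1)) K :=
  fun i l => e (i, .inr l)

/-- The sum of the tensors of the coefficient vectors and the points. -/
def tensorSum (e : Fin s × (Fin (k + 1) ⊕ Fin (r + 1)) → K) : Fin (k + 1) × Fin (r + 1) → K :=
  fun al => ∑ i, e (i, .inl al.1) * e (i, .inr al.2)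

theorem toMatrix_tensorSum (e : Fin s × (Fin (k + 1) ⊕ Fin (r + 1)) → K) :
    toMatrix (tensorSum e) = (coefMatrix e).transpose * pointMatrix e := by
  ext a l
  rw [Matrix.mul_apply]
  rfl

theorem exists_parameter {L : Type*} (A : Matrix (Fin s) (Fin (k + 1)) L)
    (x : Matrix (Fin s) (Fin (r + 1)) L) : ∃ e : Fin s × (Fin (k + 1) ⊕ Fin (r + 1)) → L, coefMatrix e = A ∧ pointMatrix e = x :=
  ⟨fun p => p.2.elim (A p.1) (x p.1), rfl, rfl⟩

variable (k s) in
/-- The parameters whose points lie on the cone over `X`. -/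
def parameters (X : Set (ℙ K (Fin (r + 1) → K))) : Set (Fin s × (Fin (k + 1) ⊕ Fin (r + 1)) → K) :=
  {e | ∀ i, (pointMatrix e).row i ∈ cone X}

/-- The parameter space is a product of `s` copies of an affine space times the cone over `X`, and
each factor is irreducible. -/
theorem isIrreducible_parameters [Infinite K] {X : Set (ℙ K (Fin (r + 1) → K))}
    (hX : IsIrreducible X) : IsIrreducible (parameters k s X) := by
  let κ := Fin (k + 1) ⊕ Fin (r + 1)
  let B : Set (κ → K) := Set.image2 Sum.elim Set.univ (cone X)
  have hB : IsIrreducible B := by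
    refine isIrreducible_image2 (fun y => ?_) (fun x => ?_) (isIrreducible_univ_affine _ _)
      (isIrreducible_cone hX)
    · convert continuous_polynomial (fun l : κ => (l.elim (fun i => MvPolynomial.X i) (fun l => C (y l)) :
        MvPolynomial (Fin (k + 1)) K)) using 3 with x l
      rcases l with i | l <;> simp
    · convert continuous_polynomial (fun l : κ => (l.elim (fun i => C (x i)) (fun l => MvPolynomial.X l) :
        MvPolynomial (Fin (r + 1)) K)) using 3 with y l
      rcases l with i | l <;> simp
  have himage : parameters k s X = (fun (b : Fin s → κ → K) (p : Fin s × κ) => b p.1 p.2) ''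
      Set.univ.pi fun _ => B := by
    ext e
    constructor
    · intro he
      refine ⟨fun i l => e (i, l), fun i _ => ⟨fun a => e (i, .inl a), trivial,
        fun l => e (i, .inr l), he i, ?_⟩, rfl⟩
      ext l
      rcases l with a | l <;> rfl
    · rintro ⟨b, hb, rfl⟩ i
      obtain ⟨x, -, y, hy, hxy⟩ := hb i trivial
      convert hy using 1
      ext l
      exact (congrFun hxy (.inr l)).symm
  rw [himage]
  refine isIrreducible_image_pi (fun x i => ?_) fun _ => hB
  convert continuous_polynomial (fun p : Fin s × κ => if p.1 = i then MvPolynomial.X p.2 else C (x p.1 p.2)) using 3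
    with b p
  by_cases hp : p.1 = i
  · rw [hp]; simp
  · simp [hp]

variable (K k r s) in
/-- The parameters with independent points and a tensor of maximal rank. -/
def regularParameters : Set (Fin s × (Fin (k + 1) ⊕ Fin (r + 1)) → K) :=
  {e | LinearIndependent K (pointMatrix e).row ∧ LinearIndependent K (toMatrix (tensorSum e)).row}

theorem isOpen_linearIndependent {ι : Type*} {n m : ℕ}
    {F : Fin (n + 1) → Fin (m + 1) → MvPolynomial ι K} :
    IsOpen {x : ι → K | LinearIndependent K (Matrix.of fun i j => eval x (F i j)).row} := by
  have : {x : ι → K | LinearIndependent K (Matrix.of fun i j => eval x (F i j)).row} =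
      ⋃ I : Fin (n + 1) ↪o Fin (m + 1),
        {x | eval x (Matrix.of fun i j => F i (I j)).det = 0}ᶜ := by
    ext x
    simp only [linearIndependent_iff_exists_minors, Set.mem_ofPred_eq, Set.mem_iUnion,
      Set.mem_compl_iff]
    refine exists_congr fun I => not_congr ?_
    rw [RingHom.map_det]
    rfl
  rw [this]
  exact isOpen_iUnion fun I => (isClosed_zeros _).isOpen_compl

/-- Both conditions say that some maximal minor is nonzero. The form `s + 1` fits the indexing of
`minors`. -/
theorem isOpen_regularParameters : IsOpen (regularParameters K k r (s + 1)) := by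
  have h1 := isOpen_linearIndependent (F := fun (i : Fin (s + 1)) (l : Fin (r + 1)) =>
    (X (i, .inr l) : MvPolynomial (Fin (s + 1) × (Fin (k + 1) ⊕ Fin (r + 1))) K))
  have h2 := isOpen_linearIndependent (K := K) (F := fun (a : Fin (k + 1)) (l : Fin (r + 1)) =>
    ∑ i : Fin (s + 1), (X (i, .inl a) * X (i, .inr l) :
      MvPolynomial (Fin (s + 1) × (Fin (k + 1) ⊕ Fin (r + 1))) K))
  convert h1.inter h2 using 1
  ext e
  have e1 : (Matrix.of fun (i : Fin (s + 1)) (l : Fin (r + 1)) => eval e (X (i, .inr l))) =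
      pointMatrix e := by
    ext i l
    simp [pointMatrix]
  have e2 : (Matrix.of fun (a : Fin (k + 1)) (l : Fin (r + 1)) => eval e (∑ i : Fin (s + 1),
      (X (i, .inl a) * X (i, .inr l)))) = toMatrix (tensorSum e) := by
    ext a l
    simp [toMatrix, tensorSum]
  rw [Set.mem_inter_iff, Set.mem_ofPred_eq, Set.mem_ofPred_eq, e1, e2]
  rfl

/-- By non-degeneracy the cone over `X` contains a basis, of which `s` vectors are taken as points.
-/
theorem exists_regular_parameter {X : Set (ℙ K (Fin (r + 1) → K))} (hX : IsNondegenerate X)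
    (hks : k + 1 ≤ s) (hsr : s ≤ r + 1) : (parameters k s X ∩ regularParameters K k r s).Nonempty := by
  have hspan : Submodule.span K (cone X) = ⊤ := by
    refine hX _ fun p hp => ?_
    rw [p.submodule_eq, Submodule.span_singleton_le_iff_mem]
    exact Submodule.subset_span (rep_mem_cone hp)
  obtain ⟨t, htX, htspan, hli⟩ := exists_linearIndependent K (cone X)
  rw [hspan] at htspan
  have : Finite t := hli.finite
  have := Fintype.ofFinite t
  have hcard : Fintype.card t = r + 1 := by
    rw [← finrank_span_eq_card hli, Subtype.range_coe, htspan, finrank_top,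
      Module.finrank_fin_fun]
  let em : Fin s ↪ t := (Fin.castLEEmb hsr).trans (Fintype.equivFinOfCardEq hcard).symm.toEmbedding
  obtain ⟨e, heA, hex⟩ := exists_parameter (L := K)
    -- With these coefficients the rows of the tensor are the first `k + 1` of the chosen points.
    (fun i a => if i = Fin.castLE hks a then 1 else 0) fun i => (em i).1
  have hx : LinearIndependent K (pointMatrix e).row := by
    rw [hex]
    exact hli.comp em em.injective
  refine ⟨e, fun i => ?_, hx, ?_⟩
  · rw [hex]
    exact htX (em i).2
  · have h1 : (toMatrix (tensorSum e)).row = (pointMatrix e).row ∘ Fin.castLE hks := by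
      funext a
      rw [toMatrix_tensorSum, mul_row_eq_sum, heA]
      simp [Matrix.transpose]
    rw [h1]
    exact hx.comp _ (Fin.castLE_injective hks)

/-- The `k`-spaces in the span of `s` independent points of `X`. -/
def spannedSpaces (X : Set (ℙ K (Fin (r + 1) → K))) (k s : ℕ) : Set (Grassmannian K k r) :=
  {W | ∃ P : Fin s → ℙ K (Fin (r + 1) → K),
    Projectivization.Independent P ∧ (∀ i, P i ∈ X) ∧ W.toSubmodule ≤ linSpan P}

theorem linSpan_mk {ι : Type*} {v : Fin s → ι → K} (hv : ∀ i, v i ≠ 0) :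
    linSpan (fun i => Projectivization.mk K (v i) (hv i)) = Submodule.span K (Set.range v) := by
  simp only [linSpan, Projectivization.submodule_mk, Submodule.span_range_eq_iSup]

/-- The rows of `M` lie in the span of the rows of `x` exactly when `M = Aᵀ x` for some `A`. This is
the dictionary between tensors and subspaces. -/
theorem rowSpace_mem_spannedSpaces_iff {X : Set (ℙ K (Fin (r + 1) → K))}
    {M : Fin (k + 1) × Fin (r + 1) → K} (hM : LinearIndependent K (toMatrix M).row) :
    rowSpace (toMatrix M) hM ∈ spannedSpaces X k s ↔
      ∃ e ∈ parameters k s X ∩ regularParameters K k r s, tensorSum e = M := by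
  constructor
  · rintro ⟨P, hP, hPX, hle⟩
    have hspan : linSpan P = Submodule.span K (Set.range fun i => (P i).rep) := by
      rw [← linSpan_mk fun i => (P i).rep_nonzero]
      simp only [Projectivization.mk_rep]
    rw [hspan] at hle
    obtain ⟨g, hg⟩ := exists_eq_mul_of_forall_mem_span (v := toMatrix M)
      (w := Matrix.of fun i => (P i).rep) fun i => hle (Submodule.subset_span ⟨i, rfl⟩)
    obtain ⟨e, heA, hex⟩ := exists_parameter g.transpose (Matrix.of fun i => (P i).rep)
    have heM : tensorSum e = M := by
      have : toMatrix (tensorSum e) = toMatrix M := by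
        rw [toMatrix_tensorSum, heA, hex, hg, Matrix.transpose_transpose]
      ext ⟨a, l⟩
      exact congrFun (congrFun this a) l
    refine ⟨e, ⟨fun i => ?_, ?_, ?_⟩, heM⟩
    · rw [hex]
      exact rep_mem_cone (hPX i)
    · rw [hex]
      exact Projectivization.independent_iff.1 hP
    · rwa [heM]
  · rintro ⟨e, ⟨heX, hex, -⟩, rfl⟩
    choose hx0 hxX using heX
    refine ⟨_, Projectivization.Independent.mk _ hx0 hex, hxX, ?_⟩
    rw [linSpan_mk, rowSpace_toSubmodule, Submodule.span_le]
    rintro _ ⟨a, rfl⟩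
    rw [toMatrix_tensorSum]
    exact mul_row_mem_span _ _ a

theorem tensorSum_ne_zero {e : Fin s × (Fin (k + 1) ⊕ Fin (r + 1)) → K}
    (he : e ∈ regularParameters K k r s) : tensorSum e ≠ 0 := by
  intro h
  refine he.2.ne_zero 0 ?_
  ext l
  exact congrFun h (0, l)

/-- The points of the projective space of tensors given by regular parameters. -/
def regularTensors (X : Set (ℙ K (Fin (r + 1) → K))) (k s : ℕ) :
    Set (ℙ K (Fin (k + 1) × Fin (r + 1) → K)) :=
  {q | ∃ e ∈ parameters k s X ∩ regularParameters K k r s, ∃ h : tensorSum e ≠ 0,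
    Projectivization.mk K (tensorSum e) h = q}

/-- For `i ≠ j`, proportional tensors would give a linear relation between the independent vectors
`x i` and `x j`. This makes the Segre points of a regular parameter distinct. -/
theorem eq_of_mk_tensor_eq {x : Matrix (Fin s) (Fin (r + 1)) K} (hx : LinearIndependent K x.row)
    {a : Fin s → Fin (k + 1) → K} (ha : ∀ i, a i ≠ 0) {i j : Fin s} {t : K}
    (h : ∀ b l, t * (a j b * x j l) = a i b * x i l) : i = j := by
  by_contra hij
  obtain ⟨b, hb⟩ := Function.ne_iff.1 (ha i)
  have hli := hx.comp ![i, j] (by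
    intro p q hpq
    fin_cases p <;> fin_cases q <;> simp_all [eq_comm])
  have h2 := LinearIndependent.pair_iff.1 (show LinearIndependent K ![x.row i, x.row j] by
    convert hli using 1
    ext p
    fin_cases p <;> rfl) (a i b) (-(t * a j b)) (by
      ext l
      have := h b l
      simp only [Pi.add_apply, Pi.smul_apply, smul_eq_mul, Pi.zero_apply, Matrix.row]
      linear_combination -this)
  exact hb h2.1

theorem regularTensors_subset (X : Set (ℙ K (Fin (r + 1) → K))) :
    regularTensors X k s ⊆ {q | ∃ P : Fin s → ℙ K (Fin (k + 1) × Fin (r + 1) → K),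
      Function.Injective P ∧ (∀ i, P i ∈ segreProduct k X) ∧ q.submodule ≤ linSpan P} := by
  classical
  rintro _ ⟨e, ⟨heX, hex, -⟩, h0, rfl⟩
  choose hx0 hxX using heX
  -- A zero coefficient vector gives no Segre point; any nonzero vector may replace it, as its term
  -- in the sum is zero.
  let a : Fin s → Fin (k + 1) → K := fun i =>
    if (coefMatrix e).row i = 0 then Pi.single 0 1 else (coefMatrix e).row i
  have ha : ∀ i, a i ≠ 0 := by
    intro i
    by_cases h : (coefMatrix e).row i = 0 <;> simp [a, h]
  let y : Fin s → Fin (k + 1) × Fin (r + 1) → K := fun i al => a i al.1 * pointMatrix e i al.2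
  have hy : ∀ i, y i ≠ 0 := fun i => segre_ne_zero (ha i) (hx0 i)
  refine ⟨fun i => Projectivization.mk K (y i) (hy i), ?_, ?_, ?_⟩
  · intro i j hij
    obtain ⟨t, ht⟩ := (Projectivization.mk_eq_mk_iff' K _ _ _ _).1 hij
    exact eq_of_mk_tensor_eq hex ha fun b l => congrFun ht (b, l)
  · intro i
    exact ⟨_, trivial, _, hxX i, segreMap_mk (ha i) (hx0 i)⟩
  · rw [Projectivization.submodule_mk, linSpan_mk, Submodule.span_singleton_le_iff_mem]
    have hsum : tensorSum e = ∑ i, fun al : Fin (k + 1) × Fin (r + 1) =>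
        coefMatrix e i al.1 * pointMatrix e i al.2 := by
      ext al
      simp [tensorSum, coefMatrix, pointMatrix]
    rw [hsum]
    refine Submodule.sum_mem _ fun i _ => ?_
    by_cases h : (coefMatrix e).row i = 0
    · convert Submodule.zero_mem _ using 1
      ext al
      have : coefMatrix e i al.1 = 0 := congrFun h al.1
      simp [this]
    · refine Submodule.subset_span ⟨i, ?_⟩
      ext al
      change a i al.1 * _ = coefMatrix e i al.1 * _
      rw [show a i = (coefMatrix e).row i from if_neg h]
      rfl

/-- The scalars of a linear combination are absorbed into the coefficient vectors. -/
theorem exists_parameter_of_mem_span {X : Set (ℙ K (Fin (r + 1) → K))}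
    {P : Fin s → ℙ K (Fin (k + 1) × Fin (r + 1) → K)} (hP : ∀ i, P i ∈ segreProduct k X)
    {v : Fin (k + 1) × Fin (r + 1) → K} (hv : v ∈ linSpan P) :
    ∃ e ∈ parameters k s X, tensorSum e = v := by
  choose p _ q hq hpq using hP
  obtain rfl : (fun i => segreMap (p i) (q i)) = P := funext hpq
  unfold segreMap at hv
  rw [linSpan_mk] at hv
  obtain ⟨c, rfl⟩ := (Submodule.mem_span_range_iff_exists_fun K).1 hv
  obtain ⟨e, heA, hex⟩ := exists_parameter (fun i a => c i * (p i).rep a) fun i => (q i).rep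
  refine ⟨e, fun i => ?_, ?_⟩
  · rw [hex]
    exact rep_mem_cone (hq i)
  · ext ⟨a, l⟩
    change ∑ i, coefMatrix e i a * pointMatrix e i l = _
    rw [heA, hex]
    simp [mul_assoc]

theorem tensorSum_mem_fractions {V : Set (Fin s × (Fin (k + 1) ⊕ Fin (r + 1)) → K)}
    (al : Fin (k + 1) × Fin (r + 1)) : (fun e : V => tensorSum e.1 al) ∈ fractions V := by
  convert eval_mem_fractions (V := V) (∑ i, X (i, .inl al.1) * X (i, .inr al.2)) using 2
  simp [tensorSum]

/-! ### Closures and irreducibility of the secant loci -/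

/-- Every point of a span comes from some parameter, and regular parameters are dense in the
irreducible parameter space; continuity carries the density over to the tensors. -/
theorem secantVariety_segreProduct [Infinite K] {X : Set (ℙ K (Fin (r + 1) → K))}
    (hirr : IsIrreducible X)
    (hne : (parameters k (s + 1) X ∩ regularParameters K k r (s + 1)).Nonempty) :
    secantVariety (segreProduct k X) (s + 1) = closure (regularTensors X k (s + 1)) := by
  refine (closure_minimal ?_ isClosed_closure).antisymm (closure_mono (regularTensors_subset X))
  rintro q ⟨P, -, hP, hle⟩
  obtain ⟨e, heX, heq⟩ := exists_parameter_of_mem_span hP (hle (by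
    rw [q.submodule_eq]; exact Submodule.mem_span_singleton_self q.rep))
  have he0 : tensorSum e ≠ 0 := by rw [heq]; exact q.rep_nonzero
  have hq : Projectivization.mk K (tensorSum e) he0 = q := by
    conv_rhs => rw [← q.mk_rep]
    congr 1
  rw [mem_closure_iff]
  intro O hO hqO
  let Φ : {e : Fin (s + 1) × (Fin (k + 1) ⊕ Fin (r + 1)) → K | tensorSum e ≠ 0} →
    ℙ K (Fin (k + 1) × Fin (r + 1) → K) := fun e => Projectivization.mk K (tensorSum e.1) e.2
  have hΦ : Continuous Φ := continuous_mk (hasClosedZeros_fractions _) tensorSum_mem_fractions _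
  obtain ⟨W, hW, hWO⟩ := isOpen_induced_iff.1 (hO.preimage hΦ)
  have heW : (⟨e, he0⟩ : {e | tensorSum e ≠ 0}) ∈ Subtype.val ⁻¹' W := by
    rw [hWO, Set.mem_preimage]
    rwa [show Φ ⟨e, he0⟩ = q from hq]
  -- Irreducibility yields a regular parameter in the prescribed neighbourhood of `e`.
  obtain ⟨e', he'X, he'W, he'R⟩ := (isIrreducible_parameters hirr).2 W _ hW isOpen_regularParameters
    ⟨e, heX, heW⟩ hne
  have he'0 := tensorSum_ne_zero he'R
  refine ⟨Φ ⟨e', he'0⟩, ?_, e', ⟨he'X, he'R⟩, he'0, rfl⟩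
  change (⟨e', he'0⟩ : {e | tensorSum e ≠ 0}) ∈ Φ ⁻¹' O
  rw [← hWO]
  exact he'W

theorem isIrreducible_preimage_parameters [Infinite K] {X : Set (ℙ K (Fin (r + 1) → K))}
    (hirr : IsIrreducible X)
    (hne : (parameters k (s + 1) X ∩ regularParameters K k r (s + 1)).Nonempty) :
    IsIrreducible (Subtype.val ⁻¹' parameters k (s + 1) X : Set (regularParameters K k r (s + 1))) := by
  rw [← isIrreducible_image_iff IsInducing.subtypeVal, Subtype.image_preimage_coe, Set.inter_comm]
  exact IsIrreducible.inter_isOpen (isIrreducible_parameters hirr) isOpen_regularParameters hne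

theorem isIrreducible_regularTensors [Infinite K] {X : Set (ℙ K (Fin (r + 1) → K))}
    (hirr : IsIrreducible X)
    (hne : (parameters k (s + 1) X ∩ regularParameters K k r (s + 1)).Nonempty) :
    IsIrreducible (regularTensors X k (s + 1)) := by
  have hΦ : Continuous fun e : regularParameters K k r (s + 1) =>
      Projectivization.mk K (tensorSum e.1) (tensorSum_ne_zero e.2) :=
    continuous_mk (hasClosedZeros_fractions _) tensorSum_mem_fractions _
  convert (isIrreducible_preimage_parameters hirr hne).image _ hΦ.continuousOn using 1
  ext q
  constructor
  · rintro ⟨e, ⟨heX, heR⟩, h0, rfl⟩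
    exact ⟨⟨e, heR⟩, heX, rfl⟩
  · rintro ⟨e, heX, rfl⟩
    exact ⟨e.1, ⟨heX, e.2⟩, _, rfl⟩

theorem isIrreducible_spannedSpaces [Infinite K] {X : Set (ℙ K (Fin (r + 1) → K))}
    (hirr : IsIrreducible X)
    (hne : (parameters k (s + 1) X ∩ regularParameters K k r (s + 1)).Nonempty) :
    IsIrreducible (spannedSpaces X k (s + 1)) := by
  have hΦ : Continuous fun e : regularParameters K k r (s + 1) =>
      rowSpace (toMatrix (tensorSum e.1)) e.2.2 :=
    continuous_rowSpace (v := fun e : regularParameters K k r (s + 1) => toMatrix (tensorSum e.1))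
      (hasClosedZeros_fractions _) (fun i j => tensorSum_mem_fractions (i, j)) _
  convert (isIrreducible_preimage_parameters hirr hne).image _ hΦ.continuousOn using 1
  ext W
  constructor
  · intro hW
    have hW' : rowSpace (toMatrix fun al : Fin (k + 1) × Fin (r + 1) => W.matrix al.1 al.2)
        W.linearIndependent_matrix ∈ spannedSpaces X k (s + 1) := by
      have := rowSpace_matrix W
      exact this.symm ▸ hW
    obtain ⟨e, ⟨heX, heR⟩, heW⟩ := (rowSpace_mem_spannedSpaces_iff _).1 hW'
    refine ⟨⟨e, heR⟩, heX, ?_⟩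
    refine Eq.trans ?_ (rowSpace_matrix W)
    simp only [heW]
    rfl
  · rintro ⟨e, heX, rfl⟩
    exact (rowSpace_mem_spannedSpaces_iff _).2 ⟨e.1, ⟨heX, e.2⟩, rfl⟩

end Parameters

/-! ### The dimension of secant varieties of Segre products -/

/-- The inverse is the adjugate, whose entries are determinants, divided by the determinant. -/
theorem inv_mul_mem_fractions {K ι n l : Type*} [Field K] [Fintype n] [DecidableEq n]
    {V : Set (ι → K)} {A : V → Matrix n n K} {M : V → Matrix n l K}
    (hA : ∀ i j, (fun v => A v i j) ∈ fractions V) (hM : ∀ i j, (fun v => M v i j) ∈ fractions V)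
    (h0 : ∀ v, (A v).det ≠ 0) (i : n) (j : l) :
    (fun v => ((A v)⁻¹ * M v) i j) ∈ fractions V := by
  have hadj : ∀ a b, (fun v => (A v).adjugate a b) ∈ fractions V := by
    intro a b
    simp only [Matrix.adjugate_apply]
    refine det_mem_subalgebra (M := fun v => (A v).updateRow b (Pi.single a 1)) fun c d => ?_
    by_cases hc : c = b
    · subst hc
      simp only [Matrix.updateRow_self]
      exact (fractions V).algebraMap_mem (Pi.single (M := fun _ => K) a 1 d)
    · simp only [Matrix.updateRow_ne hc]
      exact hA c d
  have h : (fun v => ((A v)⁻¹ * M v) i j) =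
      (fun v => ((A v).det)⁻¹) * ∑ a, (fun v => (A v).adjugate i a) * fun v => M v a j := by
    ext v
    simp [Matrix.inv_def, Matrix.mul_apply, Finset.mul_sum, mul_assoc]
  rw [h]
  exact mul_mem (inv_mem_fractions (det_mem_subalgebra hA) h0)
    (sum_mem fun a _ => mul_mem (hadj i a) (hM a j))

section Cell

variable {K : Type*} [Field K] {k r : ℕ}

/-- The square submatrix with columns `I`. -/
def columns (I : Fin (k + 1) ↪o Fin (r + 1)) (M : Fin (k + 1) × Fin (r + 1) → K) :
    Matrix (Fin (k + 1)) (Fin (k + 1)) K := (toMatrix M).submatrix id I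

/-- The matrices with entry `1` in position `(c, I 0)` whose minor `I` does not vanish. -/
def tensorCell (K : Type*) [Field K] (I : Fin (k + 1) ↪o Fin (r + 1)) (c : Fin (k + 1)) :
    Set (Fin (k + 1) × Fin (r + 1) → K) :=
  {M | M ∈ hyperplane K (c, I 0) ∧ (columns I M).det ≠ 0}

theorem isOpen_det_columns_ne_zero (I : Fin (k + 1) ↪o Fin (r + 1)) :
    IsOpen {M : Fin (k + 1) × Fin (r + 1) → K | (columns I M).det ≠ 0} := by
  have : {M : Fin (k + 1) × Fin (r + 1) → K | (columns I M).det ≠ 0} =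
      {M | eval M (Matrix.of fun i j => (X (i, I j) : MvPolynomial _ K)).det = 0}ᶜ := by
    ext M
    rw [Set.mem_compl_iff, Set.mem_ofPred_eq, Set.mem_ofPred_eq, RingHom.map_det]
    refine not_congr (Eq.congr_left ?_)
    congr 1
    ext i j
    simp [columns, toMatrix]
  rw [this]
  exact (isClosed_zeros _).isOpen_compl

theorem linearIndependent_of_det_columns {I : Fin (k + 1) ↪o Fin (r + 1)}
    {M : Fin (k + 1) × Fin (r + 1) → K} (hM : (columns I M).det ≠ 0) :
    LinearIndependent K (toMatrix M).row := linearIndependent_of_det_ne_zero hM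

/-- The product of a square matrix and a matrix. -/
def mulTensor (g : Matrix (Fin (k + 1)) (Fin (k + 1)) K) (N : Fin (k + 1) × Fin (r + 1) → K) :
    Fin (k + 1) × Fin (r + 1) → K := fun al => (g * toMatrix N) al.1 al.2

theorem toMatrix_mulTensor (g : Matrix (Fin (k + 1)) (Fin (k + 1)) K)
    (N : Fin (k + 1) × Fin (r + 1) → K) : toMatrix (mulTensor g N) = g * toMatrix N := rfl

theorem columns_mulTensor (I : Fin (k + 1) ↪o Fin (r + 1))
    (g : Matrix (Fin (k + 1)) (Fin (k + 1)) K) (N : Fin (k + 1) × Fin (r + 1) → K) :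
    columns I (mulTensor g N) = g * columns I N := rfl

theorem columns_mulTensor_of_mem {I : Fin (k + 1) ↪o Fin (r + 1)}
    (g : Matrix (Fin (k + 1)) (Fin (k + 1)) K) {N : Fin (k + 1) × Fin (r + 1) → K}
    (hN : N ∈ grassmannCell K I) : columns I (mulTensor g N) = g := by
  rw [columns_mulTensor, show columns I N = 1 from hN, mul_one]

/-- The normalization of a matrix. -/
def normalize (I : Fin (k + 1) ↪o Fin (r + 1)) (M : Fin (k + 1) × Fin (r + 1) → K) :
    Fin (k + 1) × Fin (r + 1) → K := mulTensor (columns I M)⁻¹ M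

theorem normalize_mem {I : Fin (k + 1) ↪o Fin (r + 1)} {M : Fin (k + 1) × Fin (r + 1) → K}
    (hM : (columns I M).det ≠ 0) : normalize I M ∈ grassmannCell K I :=
  Matrix.nonsing_inv_mul _ hM.isUnit

theorem mulTensor_normalize {I : Fin (k + 1) ↪o Fin (r + 1)} {M : Fin (k + 1) × Fin (r + 1) → K}
    (hM : (columns I M).det ≠ 0) : mulTensor (columns I M) (normalize I M) = M := by
  have : columns I M * ((columns I M)⁻¹ * toMatrix M) = toMatrix M :=
    Matrix.mul_nonsing_inv_cancel_left _ _ hM.isUnit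
  ext ⟨a, l⟩
  exact congrFun (congrFun this a) l

theorem normalize_mulTensor {I : Fin (k + 1) ↪o Fin (r + 1)}
    {g : Matrix (Fin (k + 1)) (Fin (k + 1)) K} (hg : g.det ≠ 0)
    {N : Fin (k + 1) × Fin (r + 1) → K} (hN : N ∈ grassmannCell K I) :
    normalize I (mulTensor g N) = N := by
  have : g⁻¹ * (g * toMatrix N) = toMatrix N := Matrix.nonsing_inv_mul_cancel_left _ _ hg.isUnit
  rw [normalize, columns_mulTensor_of_mem g hN]
  ext ⟨a, l⟩
  exact congrFun (congrFun this a) l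

theorem mulTensor_mem_tensorCell {I : Fin (k + 1) ↪o Fin (r + 1)} {c : Fin (k + 1)}
    {g : Matrix (Fin (k + 1)) (Fin (k + 1)) K} (hc : g c 0 = 1) (hg : g.det ≠ 0)
    {N : Fin (k + 1) × Fin (r + 1) → K} (hN : N ∈ grassmannCell K I) :
    mulTensor g N ∈ tensorCell K I c := by
  have h := columns_mulTensor_of_mem g hN
  refine ⟨?_, by rwa [h]⟩
  exact (congrFun (congrFun h c) 0).trans hc

theorem normalize_mem_fractions (I : Fin (k + 1) ↪o Fin (r + 1)) (c : Fin (k + 1))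
    (al : Fin (k + 1) × Fin (r + 1)) :
    (fun M : tensorCell K I c => normalize I M.1 al) ∈ fractions (tensorCell K I c) :=
  inv_mul_mem_fractions (A := fun M : tensorCell K I c => columns I M.1)
    (M := fun M : tensorCell K I c => toMatrix M.1) (fun i j => coord_mem_fractions (i, I j))
    (fun i j => coord_mem_fractions (i, j)) (fun M => M.2.2) al.1 al.2

/-- The map from matrices to their normalizations. -/
def cellNormalize (I : Fin (k + 1) ↪o Fin (r + 1)) (c : Fin (k + 1)) (M : tensorCell K I c) :
    grassmannCell K I := ⟨normalize I M.1, normalize_mem M.2.2⟩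

theorem continuous_cellNormalize (I : Fin (k + 1) ↪o Fin (r + 1)) (c : Fin (k + 1)) :
    Continuous (cellNormalize (K := K) I c) :=
  Continuous.subtype_mk (continuous_affine (hasClosedZeros_fractions _)
    (normalize_mem_fractions I c)) _

/-- Through each `M` passes a continuous section, which keeps the square factor of `M` and varies
the normalized matrix. -/
theorem isOpenMap_cellNormalize (I : Fin (k + 1) ↪o Fin (r + 1)) (c : Fin (k + 1)) :
    IsOpenMap (cellNormalize (K := K) I c) := by
  refine IsOpenMap.of_sections fun M => ?_
  have hc : columns I M.1 c 0 = 1 := M.2.1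
  refine ⟨fun N => ⟨mulTensor (columns I M.1) N.1, mulTensor_mem_tensorCell hc M.2.2 N.2⟩, ?_, ?_, ?_⟩
  · refine Continuous.continuousAt (Continuous.subtype_mk (continuous_affine
      (φ := fun N : grassmannCell K I => mulTensor (columns I M.1) N.1)
      (hasClosedZeros_fractions _) fun al => ?_) _)
    convert eval_mem_fractions (V := grassmannCell K I)
      (∑ b, C (columns I M.1 al.1 b) * X (b, al.2)) using 2 with N
    simp [mulTensor, Matrix.mul_apply, toMatrix]
  · exact Subtype.ext (mulTensor_normalize M.2.2)
  · intro N
    exact Subtype.ext (normalize_mulTensor M.2.2 N.2)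

/-- The chart of the projective space of tensors. -/
def tensorChart (I : Fin (k + 1) ↪o Fin (r + 1)) (c : Fin (k + 1)) (M : tensorCell K I c) :
    ℙ K (Fin (k + 1) × Fin (r + 1) → K) :=
  projChart K (c, I 0) ⟨M.1, M.2.1⟩

theorem isOpenEmbedding_tensorChart (I : Fin (k + 1) ↪o Fin (r + 1)) (c : Fin (k + 1)) :
    IsOpenEmbedding (tensorChart (K := K) I c) := by
  have hsub : tensorCell K I c ⊆ hyperplane K (c, I 0) := fun M hM => hM.1
  refine (isOpenEmbedding_projChart K (c, I 0)).comp ⟨IsEmbedding.inclusion hsub, ?_⟩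
  rw [Set.range_inclusion hsub]
  have := (isOpen_det_columns_ne_zero (K := K) I).preimage
    (continuous_subtype_val (p := (· ∈ hyperplane K (c, I 0))))
  convert this using 1
  ext M
  exact ⟨fun h => h.2, fun h => ⟨M.2, h⟩⟩

theorem grassmannChart_cellNormalize (I : Fin (k + 1) ↪o Fin (r + 1)) (c : Fin (k + 1))
    (M : tensorCell K I c) : grassmannChart K I (cellNormalize I c M) =
      rowSpace (toMatrix M.1) (linearIndependent_of_det_columns M.2.2) :=
  rowSpace_eq_of_mul _ _ (toMatrix_mulTensor _ _)

/-! ### Local triviality over the Grassmannian -/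

/-- Scaling the tensor or multiplying it on the left by an invertible matrix does not change its row
space, so membership depends on the normalization alone. -/
theorem preimage_regularTensors (X : Set (ℙ K (Fin (r + 1) → K))) (s : ℕ)
    (I : Fin (k + 1) ↪o Fin (r + 1)) (c : Fin (k + 1)) :
    tensorChart I c ⁻¹' regularTensors X k s =
      cellNormalize I c ⁻¹' (grassmannChart K I ⁻¹' spannedSpaces X k s) := by
  ext M
  rw [Set.mem_preimage, Set.mem_preimage, Set.mem_preimage, grassmannChart_cellNormalize]
  constructor
  · rintro ⟨e, he, h0, hM⟩
    obtain ⟨t, ht⟩ := (Projectivization.mk_eq_mk_iff' K _ _ _ _).1 hM.symm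
    have heq : toMatrix M.1 = (Matrix.scalar _ t : Matrix (Fin (k + 1)) (Fin (k + 1)) K) *
        toMatrix (tensorSum e) := by
      ext a l
      have := congrFun ht (a, l)
      simpa [toMatrix, Matrix.scalar_apply, Matrix.diagonal_mul] using this.symm
    rw [rowSpace_eq_of_mul _ he.2.2 heq]
    exact (rowSpace_mem_spannedSpaces_iff _).2 ⟨e, he, rfl⟩
  · intro hM
    obtain ⟨e, he, heM⟩ := (rowSpace_mem_spannedSpaces_iff _).1 hM
    refine ⟨e, he, tensorSum_ne_zero he.2, ?_⟩
    simp only [heM]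
    rfl

/-- Preimages under continuous open maps commute with closures, and all three maps are of this kind.
-/
theorem preimage_closure_regularTensors (X : Set (ℙ K (Fin (r + 1) → K))) (s : ℕ)
    (I : Fin (k + 1) ↪o Fin (r + 1)) (c : Fin (k + 1)) :
    tensorChart I c ⁻¹' closure (regularTensors X k s) =
      cellNormalize I c ⁻¹' (grassmannChart K I ⁻¹' closure (spannedSpaces X k s)) := by
  have h1 := isOpenEmbedding_tensorChart (K := K) I c
  have h2 := isOpenEmbedding_grassmannChart K I
  rw [h1.isOpenMap.preimage_closure_eq_closure_preimage h1.continuous, preimage_regularTensors,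
    h2.isOpenMap.preimage_closure_eq_closure_preimage h2.continuous,
    (isOpenMap_cellNormalize I c).preimage_closure_eq_closure_preimage
      (continuous_cellNormalize I c)]

/-- The square matrix in the first factor. -/
def factorMatrix (w : (Fin (k + 1) × Fin (k + 1)) ⊕ (Fin (k + 1) × Fin (r + 1)) → K) :
    Matrix (Fin (k + 1)) (Fin (k + 1)) K := toMatrix (w ∘ .inl)

/-- The product of the two matrices of a pair. -/
def mulPair (w : (Fin (k + 1) × Fin (k + 1)) ⊕ (Fin (k + 1) × Fin (r + 1)) → K) :
    Fin (k + 1) × Fin (r + 1) → K := mulTensor (factorMatrix w) (w ∘ .inr)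

/-- The pairs of an invertible normalized square matrix and an element of `V`. -/
def invertiblePairs (c : Fin (k + 1)) (V : Set (Fin (k + 1) × Fin (r + 1) → K)) :
    Set ((Fin (k + 1) × Fin (k + 1)) ⊕ (Fin (k + 1) × Fin (r + 1)) → K) :=
  hyperplaneProd (c, 0) V ∩ {w | (factorMatrix w).det ≠ 0}

theorem isOpen_det_factorMatrix_ne_zero :
    IsOpen {w : (Fin (k + 1) × Fin (k + 1)) ⊕ (Fin (k + 1) × Fin (r + 1)) → K |
      (factorMatrix w).det ≠ 0} := by
  have : {w : (Fin (k + 1) × Fin (k + 1)) ⊕ (Fin (k + 1) × Fin (r + 1)) → K |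
      (factorMatrix w).det ≠ 0} =
      {w | eval w (Matrix.of fun i j => (X (.inl (i, j)) : MvPolynomial _ K)).det = 0}ᶜ := by
    ext M
    rw [Set.mem_compl_iff, Set.mem_ofPred_eq, Set.mem_ofPred_eq, RingHom.map_det]
    refine not_congr (Eq.congr_left ?_)
    congr 1
    ext i j
    simp [factorMatrix, toMatrix]
  rw [this]
  exact (isClosed_zeros _).isOpen_compl

/-- Columns `I` of the product give back the square factor, and normalization gives back the other
one. -/
theorem isEmbedding_mulPair {I : Fin (k + 1) ↪o Fin (r + 1)} (c : Fin (k + 1))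
    {V : Set (Fin (k + 1) × Fin (r + 1) → K)} (hV : V ⊆ grassmannCell K I) :
    IsEmbedding fun w : invertiblePairs c V => mulPair w.1 := by
  let m : invertiblePairs c V → tensorCell K I c := fun w =>
    ⟨mulPair w.1, mulTensor_mem_tensorCell w.2.1.1 w.2.2 (hV w.2.1.2)⟩
  let u : tensorCell K I c → (Fin (k + 1) × Fin (k + 1)) ⊕ (Fin (k + 1) × Fin (r + 1)) → K :=
    fun M l => l.elim (fun ab => columns I M.1 ab.1 ab.2) (normalize I M.1)
  have hm : Continuous m := Continuous.subtype_mk (continuous_affine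
    (φ := fun w : invertiblePairs c V => mulPair w.1) (hasClosedZeros_fractions _) fun al => by
      convert eval_mem_fractions (V := invertiblePairs c V)
        (∑ b, X (.inl (al.1, b)) * X (.inr (b, al.2))) using 2 with w
      simp [mulPair, mulTensor, Matrix.mul_apply, toMatrix, factorMatrix]) _
  have hu : Continuous u := by
    refine continuous_affine (hasClosedZeros_fractions _) fun l => ?_
    rcases l with ab | al
    · exact coord_mem_fractions (ab.1, I ab.2)
    · exact normalize_mem_fractions I c al
  have hum : u ∘ m = Subtype.val := by
    funext w l
    rcases l with ab | al
    · exact congrFun (congrFun (columns_mulTensor_of_mem _ (hV w.2.1.2)) ab.1) ab.2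
    · exact congrFun (normalize_mulTensor w.2.2 (hV w.2.1.2)) al
  exact IsEmbedding.subtypeVal.comp (IsEmbedding.of_comp hm hu (by
    rw [hum]; exact IsEmbedding.subtypeVal))

theorem image_mulPair {I : Fin (k + 1) ↪o Fin (r + 1)} (c : Fin (k + 1))
    {V : Set (Fin (k + 1) × Fin (r + 1) → K)} (hV : V ⊆ grassmannCell K I) :
    mulPair '' invertiblePairs c V = {M | M ∈ tensorCell K I c ∧ normalize I M ∈ V} := by
  ext M
  constructor
  · rintro ⟨w, ⟨⟨hc, hwV⟩, hw⟩, rfl⟩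
    refine ⟨mulTensor_mem_tensorCell hc hw (hV hwV), ?_⟩
    rw [mulPair, normalize_mulTensor hw (hV hwV)]
    exact hwV
  · rintro ⟨⟨hM1, hM2⟩, hMV⟩
    refine ⟨Sum.elim (fun ab => columns I M ab.1 ab.2) (normalize I M), ⟨⟨hM1, ?_⟩, hM2⟩, ?_⟩
    · rwa [Sum.elim_comp_inr]
    · exact mulTensor_normalize hM2

theorem chartSet_closure_regularTensors (X : Set (ℙ K (Fin (r + 1) → K))) (s : ℕ)
    (I : Fin (k + 1) ↪o Fin (r + 1)) (c : Fin (k + 1)) :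
    chartSet (projChart K (c, I 0)) (closure (regularTensors X k s)) ∩
        {M | (columns I M).det ≠ 0} =
      mulPair '' invertiblePairs c
        (chartSet (grassmannChart K I) (closure (spannedSpaces X k s))) := by
  rw [image_mulPair (I := I) c (by rintro _ ⟨N, -, rfl⟩; exact N.2)]
  have key := preimage_closure_regularTensors X s I c
  ext M
  constructor
  · rintro ⟨⟨M, hM, rfl⟩, hdet⟩
    refine ⟨⟨M.2, hdet⟩, ?_⟩
    have : (⟨M.1, M.2, hdet⟩ : tensorCell K I c) ∈ tensorChart I c ⁻¹' closure (regularTensors X k s) :=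
      hM
    rw [key] at this
    exact ⟨_, this, rfl⟩
  · rintro ⟨hM, N, hN, hNM⟩
    refine ⟨⟨⟨M, hM.1⟩, ?_, rfl⟩, hM.2⟩
    have : (⟨M, hM⟩ : tensorCell K I c) ∈ cellNormalize I c ⁻¹'
        (grassmannChart K I ⁻¹' closure (spannedSpaces X k s)) := by
      rw [Set.mem_preimage, show cellNormalize I c ⟨M, hM⟩ = N from Subtype.ext hNM.symm]
      exact hN
    rw [← key] at this
    exact this

/-- A regular tensor has a nonzero minor `I`, so its column `I 0` has a nonzero entry, which scaling
turns into `1`. -/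
theorem exists_regular_chart {X : Set (ℙ K (Fin (r + 1) → K))} {s : ℕ}
    (hne : (parameters k s X ∩ regularParameters K k r s).Nonempty) :
    ∃ (I : Fin (k + 1) ↪o Fin (r + 1)) (c : Fin (k + 1)),
      (chartSet (projChart K (c, I 0)) (closure (regularTensors X k s)) ∩
        {M | (columns I M).det ≠ 0}).Nonempty := by
  obtain ⟨e, he⟩ := hne
  obtain ⟨I, hI⟩ := linearIndependent_iff_exists_minors.1 he.2.2
  have hI' : (columns I (tensorSum e)).det ≠ 0 := hI
  obtain ⟨c, hc⟩ : ∃ c, tensorSum e (c, I 0) ≠ 0 := by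
    by_contra! h
    exact hI' (Matrix.det_eq_zero_of_column_eq_zero 0 h)
  have h0 := tensorSum_ne_zero he.2
  refine ⟨I, c, (tensorSum e (c, I 0))⁻¹ • tensorSum e, ?_, ?_⟩
  · rw [mem_chartSet_projChart]
    refine ⟨inv_mul_cancel₀ hc, smul_ne_zero (inv_ne_zero hc) h0, ?_⟩
    rw [mk_eq_mk_of_smul _ h0 rfl]
    exact subset_closure ⟨e, he, h0, rfl⟩
  · have : columns I ((tensorSum e (c, I 0))⁻¹ • tensorSum e) =
        (tensorSum e (c, I 0))⁻¹ • columns I (tensorSum e) := rfl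
    rw [Set.mem_ofPred_eq, this, Matrix.det_smul]
    exact mul_ne_zero (pow_ne_zero _ (inv_ne_zero hc)) hI'

/-- One nonempty open piece of the secant variety is measured twice: as a part of that variety, and
as invertible matrices times a chart of the Grassmann secant variety. -/
theorem dim_secantVariety_segreProduct [IsAlgClosed K] {X : Set (ℙ K (Fin (r + 1) → K))}
    (hirr : IsIrreducible X) (hnondeg : IsNondegenerate X) {s : ℕ} (hks : k + 1 ≤ s)
    (hsr : s ≤ r + 1) : dim (secantVariety (segreProduct k X) s) =
      dim (grassmannSecantVariety X k s) + ((k + 1) * (k + 1) - 1) := by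
  obtain ⟨s, rfl⟩ : ∃ t, s = t + 1 := ⟨s - 1, by omega⟩
  have : Infinite K := IsAlgClosed.instInfinite
  have hne := exists_regular_parameter (k := k) hnondeg hks hsr
  rw [secantVariety_segreProduct hirr hne]
  change _ = dim (closure (spannedSpaces X k (s + 1))) + _
  have hQ := (isIrreducible_regularTensors hirr hne).closure
  have hS := (isIrreducible_spannedSpaces hirr hne).closure
  obtain ⟨n, hn⟩ := exists_isEquidim_grassmannian isClosed_closure hS
  obtain ⟨m, hm⟩ := exists_isEquidim_projective isClosed_closure hQ
  rw [hn.dim_eq hS.1, hm.dim_eq hQ.1]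
  obtain ⟨I, c, hO⟩ := exists_regular_chart hne
  have hf := isOpenEmbedding_grassmannChart K I
  have hp := isOpenEmbedding_projChart K (c, I 0)
  have h1 : IsEquidim (chartSet (projChart K (c, I 0)) (closure (regularTensors X k (s + 1))) ∩
      {M | (columns I M).det ≠ 0}) m :=
    ((isEquidim_chartSet_iff hp.isEmbedding).2 (hm.inter_isOpen hp.isOpen_range)).inter_isOpen
      (isOpen_det_columns_ne_zero I)
  have hV : (closure (spannedSpaces X k (s + 1)) ∩ Set.range (grassmannChart K I)).Nonempty := by
    rw [chartSet_closure_regularTensors] at hO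
    obtain ⟨_, w, ⟨⟨-, N, hN, -⟩, -⟩, -⟩ := hO
    exact ⟨_, hN, N, rfl⟩
  have h2 : IsEquidim (chartSet (projChart K (c, I 0)) (closure (regularTensors X k (s + 1))) ∩
      -- The `- 1` comes from normalizing one entry of the square factor to `1`, since tensors are
      -- taken up to scalar.
      {M | (columns I M).det ≠ 0}) (n + ((k + 1) * (k + 1) - 1)) := by
    rw [chartSet_closure_regularTensors, isEquidim_range_iff (isEmbedding_mulPair (I := I) c
      (by rintro _ ⟨N, -, rfl⟩; exact N.2))]
    refine IsEquidim.inter_isOpen ?_ isOpen_det_factorMatrix_ne_zero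
    convert isEquidim_hyperplaneProd (isClosed_chartSet (isClosed_grassmannCell K I) hf.continuous
      isClosed_closure) (isIrreducible_chartSet hf hS hV)
      ((isEquidim_chartSet_iff hf.isEmbedding).2 (hn.inter_isOpen hf.isOpen_range))
      ((c, 0) : Fin (k + 1) × Fin (k + 1)) using 2
    simp
  have h3 := (h1.topologicalKrullDim_eq hO).symm.trans (h2.topologicalKrullDim_eq hO)
  exact_mod_cast h3

end Cell

end SecantDefect

end

/-! ### Comparison of the two defects -/

theorem corollary5p2 {K : Type*} [Field K] [IsAlgClosed K] [CharZero K] {r : ℕ}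
    (X : Set (ℙ K (Fin (r + 1) → K))) (hclosed : IsClosed X) (hirr : IsIrreducible X)
    (hnondeg : SecantDefect.IsNondegenerate X) (k s : ℕ) (hks : (k : ℤ) ≤ (s : ℤ) - 1)
    (hsr : (s : ℤ) - 1 < (r : ℤ)) (δ : ℤ) :
    (SecantDefect.IsGrassmannDefective X k s ∧ SecantDefect.grassmannDefect X k s = δ) ↔
      (SecantDefect.IsSecantDefective (SecantDefect.segreProduct k X) s ∧ SecantDefect.secantDefect (SecantDefect.segreProduct k X) s = δ) := by
  have h1 := SecantDefect.dim_segreProduct k hclosed hirr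
  have h2 := SecantDefect.dim_secantVariety_segreProduct (k := k) hirr hnondeg (s := s)
    (by omega) (by omega)
  have h3 : (SecantDefect.dim (SecantDefect.secantVariety (SecantDefect.segreProduct k X) s) : ℤ) =
      SecantDefect.dim (SecantDefect.grassmannSecantVariety X k s) + (((k : ℤ) + 1) ^ 2 - 1) := by
    rw [h2]
    -- The subtraction in `h2` is that of natural numbers; it passes to the integers because `(k +
    -- 1)(k + 1) ≥ 1`.
    push_cast [Nat.one_le_iff_ne_zero.2 (Nat.mul_ne_zero k.succ_ne_zero k.succ_ne_zero)]
    ring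
  have h4 : SecantDefect.expDimSecant (SecantDefect.segreProduct k X) s =
      SecantDefect.expDimGrassmannSecant X k s + (((k : ℤ) + 1) ^ 2 - 1) := by
    -- A common shift of both entries moves out of the minimum.
    rw [SecantDefect.expDimSecant, SecantDefect.expDimGrassmannSecant, h1, ← min_add_add_right]
    congr 1
    · push_cast
      ring
    · rw [Fintype.card_prod, Fintype.card_fin, Fintype.card_fin]
      push_cast
      ring
  unfold SecantDefect.IsGrassmannDefective SecantDefect.IsSecantDefective
    SecantDefect.grassmannDefect SecantDefect.secantDefect
  rw [h3, h4, add_sub_add_right_eq_sub, Ne, Ne, add_left_inj]
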